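/- Strings are finite words over a totally ordered alphabet, compared lexicographically; a rotation of $w$ is a word $w[i..|w|)\,w[0..i)$ with $0\le i<|w|$, and a nonempty word is a Lyndon word if it is strictly smaller than each of its rotations with $1\le i<|w|$. Every word has a unique factorization into a non-increasing sequence of Lyndon words (its Lyndon factors, listed with multiplicity). $\mathsf{BWT}(w)$ is the sequence of last symbols of all $|w|$ rotations of $w$, taken in lexicographic order of the rotations; $\mathsf{BBWT}(w)$ is the sequence of last symbols of all the rotations of all the Lyndon factors of $w$, taken in the $\omega$-order, which compares $x$ and $y$ by comparing the infinite words $x^\infty$ and $y^\infty$ lexicographically. For letters $\mathtt a<\mathtt b$ the Fibonacci words are $F_0=\mathtt b$, $F_1=\mathtt a$, $F_i=F_{i-1}F_{i-2}$ for $i\ge2$. For a nonempty string $w$ consider the following measures. - $\delta(w)=\max_{1\le k\le |w|}S_k/k$, where $S_k$ is the number of distinct substrings of $w$ of length $k$. - $\gamma(w)$ is the size of a smallest string attractor of $w$, i.e. of a set $\Gamma$ of positions such that every nonempty substring of $w$ has an occurrence covering a position in $\Gamma$. - $b(w)$ is the least number of phrases of a bidirectional macro scheme of $w$, i.e. of a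 partition of $w$ into phrases, each of which is a single explicit symbol or a nonempty substring with another occurrence in $w$ chosen as its source, such that the induced references between positions are acyclic. - $z(w)$ is the number of phrases of the LZ77 factorization: from left to right, the next phrase is the longest prefix of the remaining word that also occurs at a smaller starting position of $w$ (overlaps allowed), or a single symbol if there is no nonempty such prefix. - $v(w)$ is the number of phrases of the lex-parse: as for $z$, but the other occurrence must start at a position $j$ such that the rotation of $w$ starting at $j$ is lexicographically smaller than the rotation starting at the current position. - $r(w)$ is the number of maximal runs of equal symbols in $\mathsf{BWT}(w)$. - $g(w)$ is the least size (sum of the lengths of the right-hand sides) of a straight-line context-free grammar generating exactly $w$, and $g_{\mathrm{rl}}(w)$ is the same when run-length rules $A\to X^t$, counted with size $2$, are also allowed. **Theorem.** There is an absolute constant $C>0$ such that the following holds. Let $w$ be any string for which $\mathsf{BBWT}(w)$ is a Fibonacci word of length $n\ge2$. Then for every $\mu\in\{\delta,\gamma,b,v,r\}$, $$\mu(\mathsf{BBWT}(w))\le C\,\frac{\log n}{n}\,\mu(w),$$ and for every $\mu\in\{z,g_{\mathrm{rl}},g\}$, $$\mu(\mathsf{BBWT}(w))\le C\,\frac{\log^2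 n}{n}\,\mu(w).$$ Moreover, $w$ is highly incompressible, in that $n/\log n\le C\,\mu(w)$ for all eight measures $\mu$ (in particular $\delta(w)=\Omega(n/\log n)$), whereas $\mathsf{BBWT}(w)$ is highly compressible: $\mu(\mathsf{BBWT}(w))\le C$ for $\mu\in\{\delta,\gamma,b,v,r\}$ and $\mu(\mathsf{BBWT}(w))\le C\log n$ for $\mu\in\{z,g_{\mathrm{rl}},g\}$. -/

import Mathlib

/-! Strings are lists over a linearly ordered alphabet `α`; positions are `0`-based.  The order on
`List α` is the lexicographic one, and `w.rotate i` is the cyclic left rotation by `i` symbols. -/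

namespace StringMeasures

/-! ### Fibonacci words -/

/-- The Fibonacci words over the letters `a`, `b`: `F₀ = b`, `F₁ = a`, `Fᵢ = Fᵢ₋₁ Fᵢ₋₂`. -/
def fibWord {α : Type*} (a b : α) : ℕ → List α
  | 0 => [b]
  | 1 => [a]
  | i + 2 => fibWord a b (i + 1) ++ fibWord a b i

/-! ### Lyndon factorization -/

/-- A Lyndon word: a nonempty word strictly smaller than all its proper rotations. -/
def IsLyndon {α : Type*} [LinearOrder α] (w : List α) : Prop :=
  w ≠ [] ∧ ∀ i, 1 ≤ i → i < w.length → w < w.rotate i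

/-- `L` is the list of Lyndon factors of `w`, in order and with multiplicities:
`w` is the concatenation of `L`, and `L` is a non-increasing sequence of Lyndon words. -/
def IsLyndonFactorization {α : Type*} [LinearOrder α] (w : List α) (L : List (List α)) : Prop :=
  L.flatten = w ∧ (∀ u ∈ L, IsLyndon u) ∧ L.Pairwise (· ≥ ·)

theorem append_lt_append_of_lt {α : Type*} [LinearOrder α] {s t : List α} (h : s < t)
    (hp : ¬ s <+: t) (x y : List α) : s ++ x < t ++ y := by
  induction s generalizing t with
  | nil => simp at hp
  | cons c s ih =>
    cases t with
    | nil => simp at h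
    | cons d t =>
      rw [List.cons_lt_cons_iff] at h
      rw [List.cons_append, List.cons_append, List.cons_lt_cons_iff]
      rcases h with h | ⟨rfl, h⟩
      · exact Or.inl h
      · refine Or.inr ⟨rfl, ih h ?_⟩
        intro hst
        exact hp (by simpa using hst)

theorem append_lt_append_left_iff {α : Type*} [LinearOrder α] (s x y : List α) :
    s ++ x < s ++ y ↔ x < y := by
  induction s with
  | nil => simp
  | cons c s ih => simp [ih]

/-- A nonempty word smaller than all its proper nonempty suffixes is a Lyndon word. -/
theorem isLyndon_of_suffix {α : Type*} [LinearOrder α] {s : List α} (hs : s ≠ [])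
    (h : ∀ y, y ≠ [] → y <:+ s → s ≤ y) : IsLyndon s := by
  refine ⟨hs, fun i hi hi' => ?_⟩
  rw [List.rotate_eq_drop_append_take hi'.le]
  have hne : s.drop i ≠ [] := by simpa using hi'
  have hle := h _ hne (List.drop_suffix i s)
  have hlen : (s.drop i).length < s.length := by simp; omega
  have hlt : s < s.drop i := lt_of_le_of_ne hle fun e => by
    rw [← e] at hlen; exact lt_irrefl _ hlen
  have := append_lt_append_of_lt hlt (fun hp => by have := hp.length_le; omega) [] (s.take i)
  simpa using this

/-- Every word has a Lyndon factorization (whose last factor is the smallest nonempty suffix). -/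
theorem exists_isLyndonFactorization_aux {α : Type*} [LinearOrder α] (n : ℕ) :
    ∀ w : List α, w.length = n → w = [] ∨ ∃ L s, IsLyndonFactorization w (L ++ [s]) ∧
      ∀ y, y ≠ [] → y <:+ w → s ≤ y := by
  induction n using Nat.strong_induction_on with
  | _ n ih =>
    intro w hw
    by_cases hw0 : w = []
    · exact Or.inl hw0
    right
    obtain ⟨s, ⟨hs0, hsw⟩, hmin⟩ : ∃ s, (s ≠ [] ∧ s <:+ w) ∧ ∀ y, y ≠ [] → y <:+ w → s ≤ y := by
      have hfin : {y : List α | y ≠ [] ∧ y <:+ w}.Finite :=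
        (w.tails.toFinset.finite_toSet).subset fun y hy => by simpa using hy.2
      obtain ⟨s, hs, h⟩ := Set.exists_min_image _ id hfin ⟨w, hw0, List.suffix_refl w⟩
      exact ⟨s, hs, fun y h1 h2 => h y ⟨h1, h2⟩⟩
    have hly : IsLyndon s := isLyndon_of_suffix hs0 fun y h1 h2 => hmin y h1 (h2.trans hsw)
    obtain ⟨w', rfl⟩ := hsw
    have hspos : 0 < s.length := List.length_pos_iff.2 hs0
    rcases ih w'.length (by simp at hw; omega) w' rfl with rfl | ⟨L, t, ⟨hf, hL, hP⟩, ht⟩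
    · exact ⟨[], s, ⟨by simp, by simpa using hly, by simp⟩, hmin⟩
    refine ⟨L ++ [t], s, ⟨by simp [← hf], ?_, ?_⟩, hmin⟩
    · intro u hu
      rcases List.mem_append.1 hu with hu | hu
      · exact hL u hu
      · rw [List.mem_singleton.1 hu]; exact hly
    · have hts : s ≤ t := by
        by_contra! hlt
        have htne : t ≠ [] := (hL t (by simp)).1
        have htsuf : t <:+ w' := ⟨L.flatten, by simp [← hf]⟩
        have hle : s ≤ t ++ s := hmin _ (by simp [hs0])
          (by obtain ⟨q, hq⟩ := htsuf; exact ⟨q, by simp [← hq]⟩)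
        by_cases hp : t <+: s
        · obtain ⟨y, rfl⟩ := hp
          have hy0 : y ≠ [] := by
            rintro rfl
            simp at hlt
          have hy : t ++ y ≤ y := hmin y hy0 ⟨w' ++ t, by simp⟩
          have h2 : ¬ (t ++ (t ++ y) < t ++ y) := not_lt.2 hle
          rw [append_lt_append_left_iff, not_lt] at h2
          have h3 := le_antisymm hy h2
          have h4 := congrArg List.length h3
          have : 0 < t.length := List.length_pos_iff.2 htne
          simp at h4
          exact htne h4
        · have := append_lt_append_of_lt hlt hp s []
          rw [List.append_nil] at this
          exact absurd hle (not_le.2 this)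
      rw [List.pairwise_append]
      refine ⟨hP, by simp, ?_⟩
      intro x hx y hy
      rw [List.mem_singleton.1 hy]
      refine le_trans hts ?_
      rcases List.mem_append.1 hx with hx | hx
      · exact (List.pairwise_append.1 hP).2.2 x hx t (by simp)
      · rw [List.mem_singleton.1 hx]

theorem exists_isLyndonFactorization {α : Type*} [LinearOrder α] (w : List α) :
    ∃ L, IsLyndonFactorization w L := by
  rcases exists_isLyndonFactorization_aux _ w rfl with rfl | ⟨L, s, h, _⟩
  · exact ⟨[], by simp [IsLyndonFactorization]⟩
  · exact ⟨_, h⟩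

/-- The Lyndon factors of `w`, in order and with multiplicities (the factorization is unique). -/
noncomputable def lyndonFactors {α : Type*} [LinearOrder α] (w : List α) : List (List α) :=
  (exists_isLyndonFactorization w).choose

/-! ### Burrows-Wheeler transforms -/

/-- All `|w|` rotations of `w`, as a list with multiplicities. -/
def rotations {α : Type*} (w : List α) : List (List α) :=
  (List.range w.length).map fun i => w.rotate i

/-- The infinite word `x^∞ = x x x ⋯` of a nonempty word `x`, as an element of the set of
sequences with the lexicographic order.  (The bottom of `WithBot α` is used only if `x` is empty.)
The `ω`-order compares `x` and `y` by comparing `x^∞` and `y^∞`. -/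
def omegaPower {α : Type*} (x : List α) : Lex (ℕ → WithBot α) :=
  toLex fun i => (x[i % x.length]? : Option α)

/-- The Burrows-Wheeler transform: the last symbols of all rotations of `w`, in lexicographic order
of the rotations. -/
def bwt {α : Type*} [LinearOrder α] (w : List α) : List α :=
  ((rotations w).insertionSort (· ≤ ·)).filterMap List.getLast?

/-- The bijective Burrows-Wheeler transform: the last symbols of all the rotations of all the Lyndon
factors of `w`, in `ω`-order of the rotations. -/
noncomputable def bbwt {α : Type*} [LinearOrder α] (w : List α) : List α :=
  (((lyndonFactors w).flatMap rotations).insertionSort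
    fun x y => omegaPower x ≤ omegaPower y).filterMap List.getLast?

/-! ### Repetitiveness measures -/

/-- The substring of `w` of length `l` at position `i` (for `i + l ≤ |w|`). -/
def factor {α : Type*} (w : List α) (i l : ℕ) : List α := (w.drop i).take l

/-- The number `S_k` of distinct substrings of length `k`. -/
noncomputable def substringCount {α : Type*} (w : List α) (k : ℕ) : ℕ :=
  {x : List α | x <:+: w ∧ x.length = k}.ncard

/-- The measure `δ(w) = max_{1 ≤ k ≤ |w|} S_k / k` (and `0` for the empty word). -/
noncomputable def delta {α : Type*} (w : List α) : ℝ :=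
  ((Finset.Icc 1 w.length).sup fun k => (substringCount w k : NNReal) / (k : NNReal) : NNReal)

/-- `Γ` is a string attractor of `w`: every nonempty substring has an occurrence that covers a
position in `Γ`. -/
def IsAttractor {α : Type*} (w : List α) (Γ : Finset ℕ) : Prop :=
  (∀ p ∈ Γ, p < w.length) ∧
    ∀ i l, 0 < l → i + l ≤ w.length →
      ∃ j, j + l ≤ w.length ∧ factor w j l = factor w i l ∧ ∃ p ∈ Γ, j ≤ p ∧ p < j + l

/-- The measure `γ(w)`: the size of the smallest string attractor. -/
noncomputable def gamma {α : Type*} (w : List α) : ℕ :=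
  sInf {m | ∃ Γ : Finset ℕ, IsAttractor w Γ ∧ Γ.card = m}

/-- A phrase of a macro scheme: an explicit single symbol, or a copy of the `len` symbols
starting at position `src`. -/
inductive Phrase where
  | single : Phrase
  | copy (src len : ℕ) : Phrase

/-- The length of a phrase. -/
def Phrase.length : Phrase → ℕ
  | .single => 1
  | .copy _ len => len

/-- The position at which the `i`-th phrase of a parsing starts. -/
def phraseStart (P : List Phrase) (i : ℕ) : ℕ := ((P.take i).map Phrase.length).sum

/-- Position `p` lies in a copied phrase, and its reference is position `q`. -/
def Refers (P : List Phrase) (p q : ℕ) : Prop :=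
  ∃ i src len t, P[i]? = some (Phrase.copy src len) ∧ t < len ∧
    p = phraseStart P i + t ∧ q = src + t

/-- `P` is a bidirectional macro scheme of `w`: the phrases partition `w`, each copied phrase
is nonempty and has another occurrence in `w` as its source, and the induced references of positions
are acyclic. -/
def IsBMS {α : Type*} (w : List α) (P : List Phrase) : Prop :=
  (P.map Phrase.length).sum = w.length ∧
  (∀ i src len, P[i]? = some (Phrase.copy src len) →
    0 < len ∧ src ≠ phraseStart P i ∧ src + len ≤ w.length ∧
      factor w src len = factor w (phraseStart P i) len) ∧
  ∀ p, ¬ Relation.TransGen (Refers P) p p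

/-- The measure `b(w)`: the size of the smallest bidirectional macro scheme. -/
noncomputable def bmsSize {α : Type*} (w : List α) : ℕ :=
  sInf {m | ∃ P : List Phrase, IsBMS w P ∧ P.length = m}

/-- The number of phrases when the positions `p, …, n - 1` are parsed greedily from left to right:
the phrase at a position `q` has length `step q` if this is positive, and otherwise is a single
symbol. -/
def greedyCount (n : ℕ) (step : ℕ → ℕ) (p : ℕ) : ℕ :=
  if p < n then greedyCount n step (p + max 1 (step p)) + 1 else 0
termination_by n - p

open Classical in
/-- The largest length of a prefix of the remaining word at position `p` that also occurs at a
smaller position (the two occurrences may overlap). -/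
noncomputable def lzMatch {α : Type*} (w : List α) (p : ℕ) : ℕ :=
  Nat.findGreatest
    (fun l => p + l ≤ w.length ∧ ∃ j, j < p ∧ factor w j l = factor w p l) w.length

/-- The measure `z(w)`: the number of phrases of the LZ77 factorization. -/
noncomputable def lzSize {α : Type*} (w : List α) : ℕ :=
  greedyCount w.length (lzMatch w) 0

open Classical in
/-- The largest length of a prefix of the remaining word at position `p` that also occurs in `w` at
a position `j` such that the rotation of `w` starting at `j` is lexicographically smaller than the
one starting at `p`. -/
noncomputable def lexMatch {α : Type*} [LinearOrder α] (w : List α) (p : ℕ) : ℕ :=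
  Nat.findGreatest
    (fun l => p + l ≤ w.length ∧ ∃ j, j < w.length ∧ j + l ≤ w.length ∧
      w.rotate j < w.rotate p ∧ factor w j l = factor w p l) w.length

/-- The measure `v(w)`: the number of phrases of the lex-parse. -/
noncomputable def lexSize {α : Type*} [LinearOrder α] (w : List α) : ℕ :=
  greedyCount w.length (lexMatch w) 0

/-- The number of maximal runs of equal symbols, i.e. the size of the run-length encoding. -/
def runs {α : Type*} [DecidableEq α] (x : List α) : ℕ := (x.destutter (· ≠ ·)).length

/-- The measure `r(w)`: the size of the run-length encoded Burrows-Wheeler transform. -/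
def bwtRuns {α : Type*} [LinearOrder α] (w : List α) : ℕ := runs (bwt w)

/-- Right-hand sides of grammar rules, with terminals in `α` and nonterminals in `N`: a sequence of
symbols, or a run-length rule `X^t`. -/
inductive Rhs (α : Type*) (N : Type*) where
  | seq (l : List (α ⊕ N)) : Rhs α N
  | power (X : α ⊕ N) (t : ℕ) : Rhs α N

/-- The size of a right-hand side: the number of symbols, where run-length rules have size `2`. -/
def Rhs.size {α N : Type*} : Rhs α N → ℕ
  | .seq l => l.length
  | .power _ _ => 2

/-- The word derived from a right-hand side, given the words derived from the nonterminals. -/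
def Rhs.eval {α N : Type*} (f : N → List α) : Rhs α N → List α
  | .seq l => l.flatMap (Sum.elim (fun c => [c]) f)
  | .power X t => (List.replicate t (Sum.elim (fun c => [c]) f X)).flatten

/-- A run-length straight-line grammar: nonterminals `0, …, m` with exactly one rule each, where the
rule of nonterminal `i` uses only nonterminals smaller than `i`; the start symbol is `m`. -/
structure Grammar (α : Type*) where
  m : ℕ
  rule : (i : Fin (m + 1)) → Rhs α (Fin i)

/-- The word derived from nonterminal `i`. -/
def Grammar.expand {α : Type*} (G : Grammar α) (i : ℕ) (hi : i < G.m + 1) : List α :=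
  (G.rule ⟨i, hi⟩).eval fun j => G.expand j.1 (lt_trans j.2 hi)
termination_by i
decreasing_by exact j.2

/-- The only word generated by the grammar. -/
def Grammar.word {α : Type*} (G : Grammar α) : List α := G.expand G.m (Nat.lt_succ_self _)

/-- The size of a grammar: the sum of the sizes of the right-hand sides. -/
def Grammar.size {α : Type*} (G : Grammar α) : ℕ := ∑ i, (G.rule i).size

/-- A grammar without run-length rules, i.e. an ordinary straight-line context-free grammar. -/
def Grammar.IsPlain {α : Type*} (G : Grammar α) : Prop := ∀ i, ∃ l, G.rule i = Rhs.seq l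

/-- The measure `g(w)`: the size of the smallest straight-line grammar generating `w`. -/
noncomputable def grammarSize {α : Type*} (w : List α) : ℕ :=
  sInf {s | ∃ G : Grammar α, G.IsPlain ∧ G.word = w ∧ G.size = s}

/-- The measure `g_rl(w)`: the size of the smallest run-length straight-line grammar generating
`w`. -/
noncomputable def rlGrammarSize {α : Type*} (w : List α) : ℕ :=
  sInf {s | ∃ G : Grammar α, G.word = w ∧ G.size = s}

end StringMeasures

/-!
The eight measures of `w` are at least `δ(w)`, and the number of distinct substrings of `w` of some
logarithmic length is linear in the length, so the lower bounds on the measures of `w` all follow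
from one bound on `δ(w)` (`div_log_le_delta`).

Only three features of the transform matter for this bound: it begins with `ab`, and contains
neither `aaa` nor `bb` (`IsFibLike`). Backward search maps the interval of a word `x` in the sorted
list of rotations of the Lyndon factors to the interval of `cx` by counting occurrences of `c`. As
`aaa` and `bb` are absent, the intervals shrink geometrically down to length two, and an interval of
length two that survives moves geometrically to the beginning of the list, where `ab` ends it
(`IsFibLike.interval_le_one`). So for some `L = O(log n)` the prefixes of length `L` of the infinite
powers of all the rotations of all the Lyndon factors are distinct.

A substring of length `L` of `w` inside a Lyndon factor thus determines its position. Substrings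
across boundaries are handled by the starts of the Lyndon factors: inside a Lyndon word, every
proper suffix exceeds the word by a mismatch, whereas a suffix of `w` that starts with a factor is
smaller than all longer suffixes (`HasFactorAt.drop_lt_drop`). Therefore a substring of length `3L`
shows where factors start (`HasFactorAt.of_window`), and it determines its position as soon as a
factor starts near its beginning (`eq_of_window`). One of the two kinds of positions makes up at
least half of all positions (`le_two_mul_substringCount`).

That `δ` is below the other measures follows from `δ ≤ γ ≤ b ≤ z, v`, from counting left extensions
of cyclic substrings for `r` (`card_prefixes_rotations_succ`), and, for grammars, from the fact that
an occurrence that covers no beginning of a symbol in a right-hand side lies inside the word of a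
smaller nonterminal (`Grammar.substringCount_word_le`).

For the upper bounds, a Fibonacci word with its last two symbols swapped is a rotation of itself
(`fibWord_swap`). So the sorted rotations are obtained by repeating one rotation, which gives two
runs in the Burrows-Wheeler transform, and a lex-parse with four phrases; the latter bounds `b`, `γ`
and `δ` as well. The defining recursion yields a grammar and an LZ77 parse of logarithmic size.
-/

namespace StringMeasures

variable {α : Type*}

/-! ### Substrings and the measure `δ` -/

theorem length_factor {w : List α} {i l : ℕ} (h : i + l ≤ w.length) :
    (factor w i l).length = l := by
  simp [factor]; omega

theorem getElem?_factor (w : List α) (i l t : ℕ) :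
    (factor w i l)[t]? = if t < l then w[i + t]? else none := by
  simp [factor, List.getElem?_take]

theorem factor_eq_factor_iff {w u : List α} {i j l : ℕ} :
    factor w i l = factor u j l ↔ ∀ t < l, w[i + t]? = u[j + t]? := by
  constructor
  · intro h t ht
    have := congrArg (fun x => x[t]?) h
    simpa [getElem?_factor, ht] using this
  · intro h
    apply List.ext_getElem?
    intro t
    rw [getElem?_factor, getElem?_factor]
    split_ifs with ht
    · exact h t ht
    · rfl

theorem infix_iff_exists_factor {x w : List α} :
    x <:+: w ↔ ∃ i, i + x.length ≤ w.length ∧ factor w i x.length = x := by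
  constructor
  · rintro ⟨s, t, rfl⟩
    exact ⟨s.length, by simp, by simp [factor]⟩
  · rintro ⟨i, -, h⟩
    rw [← h]
    exact ((List.take_prefix _ _).isInfix).trans (List.drop_suffix _ _).isInfix

theorem finite_substrings (w : List α) (k : ℕ) : {x : List α | x <:+: w ∧ x.length = k}.Finite := by
  refine ((Set.finite_Iic w.length).image fun i => factor w i k).subset ?_
  rintro x ⟨hx, rfl⟩
  obtain ⟨i, hi, h⟩ := infix_iff_exists_factor.1 hx
  exact ⟨i, Set.mem_Iic.2 (by omega), h⟩

theorem substringCount_le_of_subset {w : List α} {k : ℕ} (S : Finset (List α))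
    (h : ∀ i, i + k ≤ w.length → factor w i k ∈ S) : substringCount w k ≤ S.card := by
  rw [← Set.ncard_coe_finset]
  refine Set.ncard_le_ncard ?_ S.finite_toSet
  rintro x ⟨hx, rfl⟩
  obtain ⟨i, hi, hf⟩ := infix_iff_exists_factor.1 hx
  rw [← hf]
  exact h i hi

theorem card_le_substringCount {w : List α} {k : ℕ} (P : Finset ℕ)
    (hP : ∀ p ∈ P, p + k ≤ w.length) (hinj : Set.InjOn (fun p => factor w p k) P) :
    P.card ≤ substringCount w k := by
  rw [← Set.ncard_coe_finset]
  refine Set.ncard_le_ncard_of_injOn (fun p => factor w p k) ?_ hinj (finite_substrings w k)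
  intro p hp
  have hl := length_factor (hP p hp)
  refine ⟨?_, hl⟩
  rw [infix_iff_exists_factor]
  exact ⟨p, by rw [hl]; exact hP p hp, by rw [hl]⟩

theorem delta_le {w : List α} {m : ℕ}
    (h : ∀ k, 1 ≤ k → k ≤ w.length → substringCount w k ≤ k * m) : delta w ≤ m := by
  unfold delta
  have : ((Finset.Icc 1 w.length).sup fun k => (substringCount w k : NNReal) / (k : NNReal))
      ≤ (m : NNReal) := by
    refine Finset.sup_le fun k hk => ?_
    rw [Finset.mem_Icc] at hk
    refine div_le_of_le_mul₀ (by positivity) (by positivity) ?_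
    rw [mul_comm]
    exact_mod_cast h k hk.1 hk.2
  exact_mod_cast this

theorem substringCount_le_mul_delta {w : List α} {k : ℕ} (hk : 1 ≤ k) (hk' : k ≤ w.length) :
    (substringCount w k : ℝ) ≤ k * delta w := by
  unfold delta
  have h := Finset.le_sup (f := fun k => (substringCount w k : NNReal) / (k : NNReal))
    (Finset.mem_Icc.2 ⟨hk, hk'⟩)
  have hk0 : (0 : NNReal) < k := by exact_mod_cast hk
  rw [div_le_iff₀ hk0, mul_comm] at h
  exact_mod_cast h

/-! ### String attractors and macro schemes -/

theorem isAttractor_range (w : List α) : IsAttractor w (Finset.range w.length) :=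
  ⟨fun p hp => Finset.mem_range.1 hp, fun i l hl h =>
    ⟨i, h, rfl, i, Finset.mem_range.2 (by omega), le_rfl, by omega⟩⟩

/-- A string attractor bounds the number of distinct substrings of every length. -/
theorem substringCount_le_of_isAttractor {w : List α} {Γ : Finset ℕ} (hΓ : IsAttractor w Γ)
    {k : ℕ} (hk : 1 ≤ k) : substringCount w k ≤ k * Γ.card := by
  classical
  -- an occurrence that covers `p` starts at one of the `k` positions in `(p - k, p]`
  refine (substringCount_le_of_subset
    (Γ.biUnion fun p => (Finset.Icc (p + 1 - k) p).image fun j => factor w j k) ?_).trans ?_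
  · intro i hi
    obtain ⟨j, hj, hf, p, hp, h1, h2⟩ := hΓ.2 i k hk hi
    rw [← hf, Finset.mem_biUnion]
    exact ⟨p, hp, Finset.mem_image_of_mem _ (Finset.mem_Icc.2 ⟨by omega, h1⟩)⟩
  · rw [mul_comm]
    refine Finset.card_biUnion_le_card_mul _ _ _ fun p _ => Finset.card_image_le.trans ?_
    rw [Nat.card_Icc]
    omega

theorem delta_le_gamma (w : List α) : delta w ≤ gamma w := by
  obtain ⟨Γ, hΓ, hc⟩ := Nat.sInf_mem (s := {m | ∃ Γ : Finset ℕ, IsAttractor w Γ ∧ Γ.card = m})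
    ⟨_, _, isAttractor_range w, rfl⟩
  refine delta_le fun k hk _ => ?_
  rw [gamma, ← hc]
  exact substringCount_le_of_isAttractor hΓ hk

/-- The part of a concatenation that contains a given position. -/
theorem exists_part_of_lt {β : Type*} (f : β → ℕ) (l : List β) {p : ℕ} (hp : p < (l.map f).sum) :
    ∃ l₁ x l₂, l = l₁ ++ x :: l₂ ∧ (l₁.map f).sum ≤ p ∧ p < (l₁.map f).sum + f x := by
  induction l generalizing p with
  | nil => simp at hp
  | cons y l ih =>
    by_cases h : p < f y
    · exact ⟨[], y, l, by simp, by simp, by simpa using h⟩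
    · obtain ⟨l₁, x, l₂, rfl, h1, h2⟩ := ih (p := p - f y) (by simp at hp; omega)
      exact ⟨y :: l₁, x, l₂, by simp, by simp; omega, by simp; omega⟩

theorem exists_phrase_of_lt {P : List Phrase} {p : ℕ} (hp : p < (P.map Phrase.length).sum) :
    ∃ i x, P[i]? = some x ∧ phraseStart P i ≤ p ∧ p < phraseStart P i + x.length := by
  obtain ⟨l₁, x, l₂, rfl, h1, h2⟩ := exists_part_of_lt _ P hp
  exact ⟨l₁.length, x, by simp, by simpa [phraseStart] using h1, by simpa [phraseStart] using h2⟩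

/-- The starting positions of the phrases of a macro scheme form an attractor: an occurrence that
covers none of them lies inside a copied phrase and can be moved to the source of that phrase, and
by acyclicity this process ends. -/
theorem IsBMS.isAttractor {w : List α} {P : List Phrase} (h : IsBMS w P) :
    IsAttractor w (((Finset.range P.length).image (phraseStart P)).filter (· < w.length)) := by
  obtain ⟨hsum, hcopy, hacyc⟩ := h
  refine ⟨fun p hp => (Finset.mem_filter.1 hp).2, fun i l hl hi => ?_⟩
  let R : Fin w.length → Fin w.length → Prop := fun q p => Relation.TransGen (Refers P) p q
  have : IsTrans _ R := ⟨fun a b c h1 h2 => Relation.TransGen.trans h2 h1⟩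
  have : Std.Irrefl R := ⟨fun a => hacyc a⟩
  have hwf : WellFounded R := Finite.wellFounded_of_trans_of_irrefl R
  have key : ∀ p : Fin w.length, p.1 + l ≤ w.length → ∃ j, j + l ≤ w.length ∧
      factor w j l = factor w p l ∧
      ∃ q ∈ ((Finset.range P.length).image (phraseStart P)).filter (· < w.length),
        j ≤ q ∧ q < j + l := by
    intro p
    induction p using hwf.induction with
    | _ p ih =>
      intro hp
      by_cases hcov : ∃ q ∈ ((Finset.range P.length).image (phraseStart P)).filter (· < w.length),
          p.1 ≤ q ∧ q < p.1 + l
      · exact ⟨p, hp, rfl, hcov⟩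
      obtain ⟨m, x, hx, h1, h2⟩ := exists_phrase_of_lt (P := P) (p := p.1) (by omega)
      have hm : m < P.length := (List.getElem?_eq_some_iff.1 hx).1
      have hmem : ∀ m' < P.length, phraseStart P m' < w.length →
          ¬ (p.1 ≤ phraseStart P m' ∧ phraseStart P m' < p.1 + l) := fun m' hm' hlt hc =>
        hcov ⟨_, Finset.mem_filter.2 ⟨Finset.mem_image_of_mem _ (Finset.mem_range.2 hm'), hlt⟩, hc⟩
      have hne : phraseStart P m < p.1 := by
        have := hmem m hm (by omega)
        omega
      have hsucc : phraseStart P (m + 1) = phraseStart P m + x.length := by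
        simp only [phraseStart]
        rw [List.take_add_one, hx]
        simp
      -- the next phrase starts no earlier than the end of the occurrence
      have hend : p.1 + l ≤ phraseStart P m + x.length := by
        by_contra! hlt
        rcases Nat.lt_or_ge (m + 1) P.length with hm1 | hm1
        · have := hmem (m + 1) hm1 (by omega)
          omega
        · have : phraseStart P (m + 1) = w.length := by
            rw [← hsum, phraseStart, List.take_of_length_le hm1]
          omega
      cases x with
      | single => simp only [Phrase.length] at h2; omega
      | copy src len =>
        simp only [Phrase.length] at h2 hend
        obtain ⟨_, _, hle, hf⟩ := hcopy m src len hx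
        obtain ⟨t, ht⟩ := Nat.exists_eq_add_of_le h1
        have hf' : factor w (src + t) l = factor w p l := by
          rw [factor_eq_factor_iff] at hf ⊢
          intro s hs
          rw [ht, add_assoc, add_assoc]
          exact hf (t + s) (by omega)
        obtain ⟨j, hj, hjf, hq⟩ := ih ⟨src + t, by omega⟩
          (Relation.TransGen.single ⟨m, src, len, t, hx, by omega, ht, rfl⟩) (by simp only; omega)
        exact ⟨j, hj, hjf.trans hf', hq⟩
  exact key ⟨i, by omega⟩ hi

theorem isBMS_replicate_single (w : List α) : IsBMS w (List.replicate w.length Phrase.single) := by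
  have hno : ∀ i src len : ℕ,
      (List.replicate w.length Phrase.single)[i]? ≠ some (Phrase.copy src len) := by
    intro i src len h
    rw [List.getElem?_replicate] at h
    split_ifs at h
    simp at h
  refine ⟨by simp [Phrase.length], fun i src len h => absurd h (hno _ _ _), fun p hp => ?_⟩
  obtain ⟨q, ⟨i, src, len, t, h, -⟩, -⟩ := Relation.TransGen.head'_iff.1 hp
  exact hno _ _ _ h

theorem bmsSize_le {w : List α} {P : List Phrase} (h : IsBMS w P) : bmsSize w ≤ P.length :=
  Nat.sInf_le ⟨P, h, rfl⟩

theorem gamma_le_bmsSize (w : List α) : gamma w ≤ bmsSize w := by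
  obtain ⟨P, hP, hc⟩ := Nat.sInf_mem (s := {m | ∃ P : List Phrase, IsBMS w P ∧ P.length = m})
    ⟨_, _, isBMS_replicate_single w, rfl⟩
  rw [bmsSize, ← hc]
  refine (Nat.sInf_le (⟨_, hP.isAttractor, rfl⟩ : _ ∈ {m | ∃ Γ : Finset ℕ, IsAttractor w Γ ∧
    Γ.card = m})).trans ?_
  refine (Finset.card_filter_le _ _).trans (Finset.card_image_le.trans ?_)
  simp

/-! ### Greedy parsings -/

theorem greedyCount_of_lt {n p : ℕ} (step : ℕ → ℕ) (h : p < n) :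
    greedyCount n step p = greedyCount n step (p + max 1 (step p)) + 1 := by
  rw [greedyCount, if_pos h]

theorem greedyCount_of_le {n p : ℕ} (step : ℕ → ℕ) (h : n ≤ p) : greedyCount n step p = 0 := by
  rw [greedyCount, if_neg (by omega)]

/-- The phrases of the greedy parsing, for given sources of the copied phrases. -/
theorem exists_greedy_phrases {n : ℕ} {step src : ℕ → ℕ} (hstep : ∀ p < n, p + step p ≤ n) :
    ∀ m p, n - p = m → p ≤ n → ∃ P : List Phrase, P.length = greedyCount n step p ∧
      p + (P.map Phrase.length).sum = n ∧ ∀ i s l, P[i]? = some (Phrase.copy s l) →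
        p + phraseStart P i < n ∧ 0 < l ∧ l = step (p + phraseStart P i) ∧
          s = src (p + phraseStart P i) := by
  intro m
  induction m using Nat.strong_induction_on with
  | _ m ih =>
    intro p hm hp
    rcases hp.eq_or_lt with rfl | hlt
    · exact ⟨[], by simp [greedyCount_of_le], by simp, by simp⟩
    have hs := hstep p hlt
    obtain ⟨P, hlen, hsum, hP⟩ := ih (n - (p + max 1 (step p))) (by omega) _ rfl (by omega)
    let x : Phrase := if step p = 0 then Phrase.single else Phrase.copy (src p) (step p)
    have hx : x.length = max 1 (step p) := by
      simp only [x]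
      split_ifs with h0 <;> simp only [Phrase.length] <;> omega
    refine ⟨x :: P, by rw [greedyCount_of_lt _ hlt, List.length_cons, hlen],
      by simp only [List.map_cons, List.sum_cons, hx]; omega, ?_⟩
    intro i s l hi
    cases i with
    | zero =>
      simp only [List.getElem?_cons_zero, Option.some.injEq, x] at hi
      split_ifs at hi with h0
      cases hi
      simp only [phraseStart, List.take_zero, List.map_nil, List.sum_nil, add_zero]
      exact ⟨hlt, by omega, trivial, trivial⟩
    | succ i =>
      rw [List.getElem?_cons_succ] at hi
      have hst : p + phraseStart (x :: P) (i + 1) = p + max 1 (step p) + phraseStart P i := by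
        simp only [phraseStart, List.take_succ_cons, List.map_cons, List.sum_cons, hx]
        omega
      rw [hst]
      exact hP i s l hi

/-- A greedy parsing whose copied phrases refer to positions that are smaller with respect to some
strict order is a bidirectional macro scheme. -/
theorem bmsSize_le_greedyCount {β : Type*} [Preorder β] (rank : ℕ → β) {w : List α}
    {step src : ℕ → ℕ} (hstep : ∀ p < w.length, p + step p ≤ w.length)
    (hsrc : ∀ p < w.length, src p + step p ≤ w.length)
    (hcopy : ∀ p < w.length, factor w (src p) (step p) = factor w p (step p))
    (hrank : ∀ p < w.length, ∀ t < step p, rank (src p + t) < rank (p + t)) :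
    bmsSize w ≤ greedyCount w.length step 0 := by
  obtain ⟨P, hlen, hsum, hP⟩ := exists_greedy_phrases (src := src) hstep _ 0 rfl (Nat.zero_le _)
  simp only [zero_add] at hsum hP
  rw [← hlen]
  refine bmsSize_le ⟨hsum, fun i s l hi => ?_, fun p hp => ?_⟩
  · obtain ⟨hlt, hl, rfl, rfl⟩ := hP i s l hi
    refine ⟨hl, fun he => ?_, hsrc _ hlt, hcopy _ hlt⟩
    have := hrank _ hlt 0 hl
    simp only [add_zero, he, lt_self_iff_false] at this
  · have hmono : ∀ q, Relation.TransGen (Refers P) p q → rank q < rank p := by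
      have hone : ∀ p q, Refers P p q → rank q < rank p := by
        rintro p q ⟨i, s, l, t, hi, ht, rfl, rfl⟩
        obtain ⟨hlt, hl, rfl, rfl⟩ := hP i s l hi
        exact hrank _ hlt t ht
      intro q hq
      induction hq with
      | single h => exact hone _ _ h
      | tail _ h ih => exact (hone _ _ h).trans ih
    exact lt_irrefl _ (hmono p hp)

theorem greedyCount_anti {n : ℕ} {step : ℕ → ℕ}
    (hmono : ∀ p q, p ≤ q → q < n → p + max 1 (step p) ≤ q + max 1 (step q)) :
    ∀ m p q, n - p = m → p ≤ q → greedyCount n step q ≤ greedyCount n step p := by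
  intro m
  induction m using Nat.strong_induction_on with
  | _ m ih =>
    intro p q hm hpq
    rcases Nat.lt_or_ge q n with hq | hq
    · rw [greedyCount_of_lt _ hq, greedyCount_of_lt _ (hpq.trans_lt hq)]
      exact Nat.succ_le_succ (ih (n - (p + max 1 (step p))) (by omega) _ _ rfl (hmono p q hpq hq))
    · rw [greedyCount_of_le _ hq]
      exact Nat.zero_le _

/-- The greedy parsing is optimal if the end of the phrase at `p` is a monotone function of `p`:
a phrase that ends no later than the greedy one costs one unit. -/
theorem greedyCount_le_succ {n : ℕ} {step : ℕ → ℕ}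
    (hmono : ∀ p q, p ≤ q → q < n → p + max 1 (step p) ≤ q + max 1 (step q)) {p q : ℕ}
    (h : q ≤ p + max 1 (step p)) : greedyCount n step p ≤ greedyCount n step q + 1 := by
  rcases Nat.lt_or_ge p n with hp | hp
  · rw [greedyCount_of_lt _ hp]
    exact Nat.succ_le_succ (greedyCount_anti hmono _ _ _ rfl h)
  · rw [greedyCount_of_le _ hp]
    exact Nat.zero_le _

theorem monotone_greedy_end {n : ℕ} {step : ℕ → ℕ}
    (hstep : ∀ p, p + 1 < n → step p ≤ step (p + 1) + 1) :
    ∀ p q, p ≤ q → q < n → p + max 1 (step p) ≤ q + max 1 (step q) := by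
  intro p q hpq
  induction q, hpq using Nat.le_induction with
  | base => exact fun _ => le_rfl
  | succ q hpq ih =>
    intro hq
    have h1 := ih (by omega)
    have h2 := hstep q hq
    omega

/-! ### LZ77 and the lex-parse -/

theorem lzMatch_spec (w : List α) (p : ℕ) (hp : p < w.length) : p + lzMatch w p ≤ w.length ∧
    (lzMatch w p ≠ 0 → ∃ j, j < p ∧ factor w j (lzMatch w p) = factor w p (lzMatch w p)) := by
  classical
  by_cases h0 : lzMatch w p = 0
  · exact ⟨by omega, fun h => absurd h0 h⟩
  · have := Nat.findGreatest_of_ne_zero (P := fun l => p + l ≤ w.length ∧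
      ∃ j, j < p ∧ factor w j l = factor w p l) (n := w.length) (m := lzMatch w p) rfl h0
    exact ⟨this.1, fun _ => this.2⟩

theorem le_lzMatch {w : List α} {p l j : ℕ} (hl : p + l ≤ w.length) (hj : j < p)
    (h : factor w j l = factor w p l) : l ≤ lzMatch w p := by
  classical
  exact Nat.le_findGreatest (by omega) ⟨hl, j, hj, h⟩

theorem factor_succ_of_factor {w : List α} {j p l : ℕ}
    (h : factor w j (l + 1) = factor w p (l + 1)) :
    factor w (j + 1) l = factor w (p + 1) l := by
  rw [factor_eq_factor_iff] at h ⊢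
  intro t ht
  simpa [add_assoc, add_comm 1] using h (t + 1) (by omega)

theorem lzMatch_le_succ (w : List α) (p : ℕ) (hp : p + 1 < w.length) :
    lzMatch w p ≤ lzMatch w (p + 1) + 1 := by
  obtain ⟨h1, h2⟩ := lzMatch_spec w p (by omega)
  rcases Nat.eq_zero_or_eq_succ_pred (lzMatch w p) with h0 | h0
  · omega
  · obtain ⟨j, hj, hf⟩ := h2 (by omega)
    rw [h0] at hf
    have := le_lzMatch (w := w) (p := p + 1) (l := (lzMatch w p).pred) (j := j + 1) (by omega)
      (by omega) (factor_succ_of_factor hf)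
    omega

theorem bmsSize_le_lzSize (w : List α) : bmsSize w ≤ lzSize w := by
  have : ∀ p, ∃ j, p < w.length → lzMatch w p ≠ 0 →
      j < p ∧ factor w j (lzMatch w p) = factor w p (lzMatch w p) := by
    intro p
    by_cases h : p < w.length ∧ lzMatch w p ≠ 0
    · obtain ⟨j, hj⟩ := (lzMatch_spec w p h.1).2 h.2
      exact ⟨j, fun _ _ => hj⟩
    · exact ⟨0, fun h1 h2 => absurd ⟨h1, h2⟩ h⟩
  choose src hsrc using this
  refine bmsSize_le_greedyCount (src := fun p => if lzMatch w p = 0 then 0 else src p) id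
    (fun p hp => (lzMatch_spec w p hp).1) (fun p hp => ?_) (fun p hp => ?_) (fun p hp t ht => ?_)
  all_goals
    have h1 := (lzMatch_spec w p hp).1
    by_cases h0 : lzMatch w p = 0
    · first | omega | simp [h0, factor]
    · have := hsrc p hp h0
      simp only [h0, if_false, id]
      first | exact this.2 | omega

section Lex

variable [LinearOrder α]

theorem lexMatch_spec (w : List α) (p : ℕ) (hp : p < w.length) : p + lexMatch w p ≤ w.length ∧
    (lexMatch w p ≠ 0 → ∃ j, j < w.length ∧ j + lexMatch w p ≤ w.length ∧
      w.rotate j < w.rotate p ∧ factor w j (lexMatch w p) = factor w p (lexMatch w p)) := by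
  classical
  by_cases h0 : lexMatch w p = 0
  · exact ⟨by omega, fun h => absurd h0 h⟩
  · have := Nat.findGreatest_of_ne_zero (P := fun l => p + l ≤ w.length ∧
      ∃ j, j < w.length ∧ j + l ≤ w.length ∧
      w.rotate j < w.rotate p ∧ factor w j l = factor w p l) (n := w.length)
      (m := lexMatch w p) rfl h0
    exact ⟨this.1, fun _ => this.2⟩

theorem le_lexMatch {w : List α} {p l j : ℕ} (hl : p + l ≤ w.length) (hj : j < w.length)
    (hjl : j + l ≤ w.length) (hlt : w.rotate j < w.rotate p)
    (h : factor w j l = factor w p l) : l ≤ lexMatch w p := by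
  classical
  exact Nat.le_findGreatest (by omega) ⟨hl, j, hj, hjl, hlt, h⟩

theorem append_lt_append_of_length_eq {s t x y : List α} (hl : s.length = t.length) (h : s < t) :
    s ++ x < t ++ y :=
  append_lt_append_of_lt h (fun hp => h.ne (hp.eq_of_length hl)) x y

/-- Two rotations that begin with the same symbol remain in the same order when this symbol is moved
to the end. -/
theorem rotate_succ_lt_rotate_succ {w : List α} {j p : ℕ} (hj : j < w.length) (hp : p < w.length)
    (h : w.rotate j < w.rotate p) (hc : w[j]? = w[p]?) :
    w.rotate (j + 1) < w.rotate (p + 1) := by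
  have hcons : ∀ i (hi : i < w.length), w.rotate i = w[i] :: (w.drop (i + 1) ++ w.take i) := by
    intro i hi
    rw [List.rotate_eq_drop_append_take hi.le, List.drop_eq_getElem_cons hi, List.cons_append]
  have hsucc : ∀ i (hi : i < w.length),
      w.rotate (i + 1) = (w.drop (i + 1) ++ w.take i) ++ [w[i]] := by
    intro i hi
    rw [← List.rotate_rotate, hcons i hi, List.rotate_cons_succ, List.rotate_zero]
  rw [List.getElem?_eq_getElem hj, List.getElem?_eq_getElem hp, Option.some.injEq] at hc
  rw [hcons j hj, hcons p hp, List.cons_lt_cons_iff, hc] at h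
  rw [hsucc j hj, hsucc p hp]
  refine append_lt_append_of_length_eq ?_ ?_
  · simp; omega
  · simpa using h

theorem rotate_add_lt_rotate_add {w : List α} {j p l : ℕ} (hj : j + l ≤ w.length)
    (hp : p + l ≤ w.length) (hlt : w.rotate j < w.rotate p)
    (h : factor w j l = factor w p l) : w.rotate (j + l) < w.rotate (p + l) := by
  rw [factor_eq_factor_iff] at h
  have : ∀ t ≤ l, w.rotate (j + t) < w.rotate (p + t) := by
    intro t
    induction t with
    | zero => exact fun _ => hlt
    | succ t ih =>
      intro ht
      exact rotate_succ_lt_rotate_succ (j := j + t) (p := p + t) (by omega) (by omega)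
        (ih (by omega)) (h t (by omega))
  exact this l le_rfl

/-- The lex-parse is greedy in an optimal way: cutting off the first symbol of a phrase and of its
source keeps the order of the rotations. -/
theorem lexMatch_le_succ (w : List α) (p : ℕ) (hp : p + 1 < w.length) :
    lexMatch w p ≤ lexMatch w (p + 1) + 1 := by
  obtain ⟨h1, h2⟩ := lexMatch_spec w p (by omega)
  rcases Nat.lt_or_ge (lexMatch w p) 2 with h0 | h0
  · omega
  · obtain ⟨l, hl⟩ := Nat.exists_eq_add_of_le' (show 1 ≤ lexMatch w p by omega)
    obtain ⟨j, hj, hjl, hlt, hf⟩ := h2 (by omega)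
    rw [hl] at hf
    have := le_lexMatch (w := w) (p := p + 1) (l := l) (j := j + 1) (by omega)
      (by omega) (by omega)
      (rotate_add_lt_rotate_add (by omega) (by omega) hlt
        (factor_eq_factor_iff.2 fun t ht => factor_eq_factor_iff.1 hf t (by omega)))
      (factor_succ_of_factor hf)
    omega

theorem bmsSize_le_lexSize (w : List α) : bmsSize w ≤ lexSize w := by
  have : ∀ p, ∃ j, p < w.length → lexMatch w p ≠ 0 → j < w.length ∧ j + lexMatch w p ≤ w.length ∧
      w.rotate j < w.rotate p ∧ factor w j (lexMatch w p) = factor w p (lexMatch w p) := by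
    intro p
    by_cases h : p < w.length ∧ lexMatch w p ≠ 0
    · obtain ⟨j, hj⟩ := (lexMatch_spec w p h.1).2 h.2
      exact ⟨j, fun _ _ => hj⟩
    · exact ⟨0, fun h1 h2 => absurd ⟨h1, h2⟩ h⟩
  choose src hsrc using this
  refine bmsSize_le_greedyCount (src := fun p => if lexMatch w p = 0 then 0 else src p) w.rotate
    (fun p hp => (lexMatch_spec w p hp).1) (fun p hp => ?_) (fun p hp => ?_) (fun p hp t ht => ?_)
  all_goals
    have h1 := (lexMatch_spec w p hp).1
    by_cases h0 : lexMatch w p = 0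
    · first | omega | simp [h0, factor]
    · obtain ⟨h2, h3, h4, h5⟩ := hsrc p hp h0
      simp only [h0, if_false]
      first
        | exact h3
        | exact h5
        | exact rotate_add_lt_rotate_add (by omega) (by omega) h4
            (factor_eq_factor_iff.2 fun s hs => factor_eq_factor_iff.1 h5 s (by omega))

end Lex

/-! ### Runs in the Burrows-Wheeler transform -/

theorem runs_nil {β : Type*} [DecidableEq β] : runs ([] : List β) = 0 := rfl

theorem runs_singleton {β : Type*} [DecidableEq β] (a : β) : runs [a] = 1 := rfl

theorem runs_cons_cons {β : Type*} [DecidableEq β] (a b : β) (l : List β) :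
    runs (a :: b :: l) = runs (b :: l) + if a = b then 0 else 1 := by
  unfold runs
  rw [List.destutter_cons_cons, List.destutter_cons']
  by_cases h : a = b
  · simp [h]
  · simp [h]

theorem runs_map_of_injective {β γ : Type*} [DecidableEq β] [DecidableEq γ] {f : β → γ}
    (hf : Function.Injective f) (l : List β) : runs (l.map f) = runs l := by
  induction l with
  | nil => rfl
  | cons a l ih =>
    cases l with
    | nil => rfl
    | cons b l =>
      rw [List.map_cons] at ih
      rw [List.map_cons, List.map_cons, runs_cons_cons, runs_cons_cons, ih]
      simp only [hf.eq_iff]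

theorem card_toFinset_le_runs {β : Type*} [DecidableEq β] (l : List β) :
    l.toFinset.card ≤ runs l := by
  induction l with
  | nil => simp
  | cons a l ih =>
    cases l with
    | nil => simp [runs_singleton]
    | cons b l =>
      rw [runs_cons_cons, List.toFinset_cons]
      split_ifs with h
      · rw [Finset.insert_eq_of_mem (by simp [h])]
        exact ih
      · exact (Finset.card_insert_le _ _).trans (Nat.succ_le_succ ih)

theorem runs_le_card_of_pairwise_le {β : Type*} [PartialOrder β] [DecidableEq β] {l : List β}
    (h : l.Pairwise (· ≤ ·)) : runs l ≤ l.toFinset.card := by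
  induction l with
  | nil => simp [runs_nil]
  | cons a l ih =>
    rw [List.pairwise_cons] at h
    cases l with
    | nil => simp [runs_singleton]
    | cons b l =>
      have ih := ih h.2
      rw [runs_cons_cons, List.toFinset_cons]
      split_ifs with hab
      · rw [Finset.insert_eq_of_mem (by simp [hab])]
        exact ih
      · have hlt : a < b := lt_of_le_of_ne (h.1 b (by simp)) hab
        rw [Finset.card_insert_of_notMem]
        · exact Nat.succ_le_succ ih
        · intro hmem
          rw [List.mem_toFinset] at hmem
          rcases List.mem_cons.1 hmem with h' | h'
          · exact hab h'
          · exact absurd ((List.pairwise_cons.1 h.2).1 a h') hlt.not_ge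

theorem runs_map_prod_le {β γ δ : Type*} [DecidableEq γ] [DecidableEq δ] (f : β → γ) (g : β → δ)
    {l : List β} (hl : l ≠ []) :
    runs (l.map fun y => (f y, g y)) + 1 ≤ runs (l.map f) + runs (l.map g) := by
  induction l with
  | nil => exact absurd rfl hl
  | cons a l ih =>
    cases l with
    | nil => simp [runs_singleton]
    | cons b l =>
      have ih := ih (by simp)
      simp only [List.map_cons, runs_cons_cons, Prod.mk.injEq] at ih ⊢
      split_ifs <;> first | omega | simp_all

/-- Moving the first symbol of a word to its end permutes the rotations of a word. -/
theorem map_rotate_one_rotations_perm (w : List α) :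
    ((rotations w).map fun y => y.rotate 1).Perm (rotations w) := by
  unfold rotations
  rw [List.map_map]
  rcases Nat.eq_zero_or_eq_succ_pred w.length with h | h
  · simp [h]
  · generalize w.length.pred = m at h
    rw [h]
    nth_rewrite 1 [List.range_succ]
    rw [List.range_succ_eq_map, List.map_append, List.map_cons (a := 0),
      List.map_map (l := List.range m)]
    have hlast : w.rotate (m + 1) = w.rotate 0 := by
      rw [← Nat.succ_eq_add_one, ← h, List.rotate_length, List.rotate_zero]
    have hmap : List.map ((fun y => y.rotate 1) ∘ fun i => w.rotate i) (List.range m) =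
        List.map ((fun i => w.rotate i) ∘ Nat.succ) (List.range m) := by
      refine List.map_congr_left fun i _ => ?_
      simp [List.rotate_rotate]
    rw [hmap]
    simp only [List.map_cons, List.map_nil, Function.comp_apply, List.rotate_rotate, hlast]
    exact List.perm_append_comm

theorem length_rotations (w : List α) : (rotations w).length = w.length := by
  simp [rotations]

theorem length_of_mem_rotations {w y : List α} (h : y ∈ rotations w) : y.length = w.length := by
  simp only [rotations, List.mem_map] at h
  obtain ⟨i, -, rfl⟩ := h
  simp

theorem getLast?_rotate_one (y : List α) : (y.rotate 1).getLast? = y.head? := by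
  cases y <;> simp

theorem take_succ_eq_getLast?_append {y : List α} {k : ℕ} (hk : k < y.length) :
    y.take (k + 1) = (y.rotate 1).getLast?.toList ++ (y.rotate 1).take k := by
  cases y with
  | nil => simp at hk
  | cons c y =>
    simp only [List.length_cons] at hk
    simp [List.take_append_of_le_length (show k ≤ y.length by omega)]

/-- The prefixes of length `k + 1` of the rotations are the left extensions of their prefixes of
length `k` by the last symbols, that is, by the symbols of the transform. -/
theorem map_take_succ_rotations_perm {w : List α} {k : ℕ} (hk : k < w.length) :
    ((rotations w).map (List.take (k + 1))).Perm
      ((rotations w).map fun y => y.getLast?.toList ++ y.take k) := by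
  have : (rotations w).map (List.take (k + 1)) =
      ((rotations w).map fun y => y.rotate 1).map fun y => y.getLast?.toList ++ y.take k := by
    rw [List.map_map]
    refine List.map_congr_left fun y hy => ?_
    exact take_succ_eq_getLast?_append (by rw [length_of_mem_rotations hy]; exact hk)
  rw [this]
  exact (map_rotate_one_rotations_perm w).map _

theorem map_some_filterMap {β γ : Type*} {f : β → Option γ} {l : List β}
    (h : ∀ y ∈ l, (f y).isSome) : (l.filterMap f).map some = l.map f := by
  induction l with
  | nil => rfl
  | cons a l ih =>
    obtain ⟨c, hc⟩ := Option.isSome_iff_exists.1 (h a (by simp))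
    rw [List.filterMap_cons_some hc, List.map_cons, List.map_cons, hc,
      ih fun y hy => h y (by simp [hy])]

section Runs

variable [LinearOrder α]

theorem take_le_take {x y : List α} (h : x ≤ y) (k : ℕ) : x.take k ≤ y.take k := by
  induction k generalizing x y with
  | zero => simp
  | succ k ih =>
    cases x with
    | nil => exact not_lt.1 (by simp)
    | cons c x =>
      cases y with
      | nil => exact absurd h (not_le.2 (by simp))
      | cons d y =>
        rw [← not_lt, List.cons_lt_cons_iff] at h
        rw [List.take_succ_cons, List.take_succ_cons, ← not_lt, List.cons_lt_cons_iff]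
        push Not at h ⊢
        exact ⟨h.1, fun e => ih (h.2 e)⟩

theorem runs_bwt (w : List α) :
    runs (((rotations w).insertionSort (· ≤ ·)).map List.getLast?) = bwtRuns w := by
  have hs : ∀ y ∈ (rotations w).insertionSort (· ≤ ·), (y.getLast?).isSome := by
    intro y hy
    rw [List.mem_insertionSort] at hy
    have h1 : 0 < (rotations w).length := List.length_pos_of_mem hy
    rw [length_rotations, ← length_of_mem_rotations hy, List.length_pos_iff] at h1
    simpa using h1
  rw [← map_some_filterMap hs]
  exact runs_map_of_injective (Option.some_injective α) _

/-- The number of distinct cyclic substrings grows with their length by at most the number of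
boundaries between runs: the left extensions of a cyclic substring `x` are counted by the distinct
symbols in the interval of the transform that belongs to `x`. -/
theorem card_prefixes_rotations_succ {w : List α} {k : ℕ} (hk : k < w.length) :
    ((rotations w).map (List.take (k + 1))).toFinset.card + 1 ≤
      ((rotations w).map (List.take k)).toFinset.card + bwtRuns w := by
  set R := (rotations w).insertionSort (· ≤ ·) with hR
  have hperm : R.Perm (rotations w) := List.perm_insertionSort _ _
  have hne : R ≠ [] := by
    rw [← List.length_pos_iff, hperm.length_eq, length_rotations]
    omega
  have h1 : ((rotations w).map (List.take (k + 1))).toFinset =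
      (R.map fun y => (y.getLast?, y.take k)).toFinset.image fun z => z.1.toList ++ z.2 := by
    rw [List.toFinset_eq_of_perm _ _ (map_take_succ_rotations_perm hk),
      ← List.toFinset_eq_of_perm _ _ (hperm.map _)]
    ext x
    simp
  have h2 : ((rotations w).map (List.take k)).toFinset = (R.map (List.take k)).toFinset :=
    List.toFinset_eq_of_perm _ _ (hperm.symm.map _)
  have h3 : runs (R.map (List.take k)) ≤ (R.map (List.take k)).toFinset.card := by
    refine runs_le_card_of_pairwise_le (List.pairwise_map.2 ?_)
    exact (List.pairwise_insertionSort (· ≤ ·) (rotations w)).imp fun h => take_le_take h k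
  rw [h1, h2]
  have h4 := runs_map_prod_le List.getLast? (List.take k) hne
  have h5 := card_toFinset_le_runs (R.map fun y => (y.getLast?, y.take k))
  have h6 := Finset.card_image_le (s := (R.map fun y => (y.getLast?, y.take k)).toFinset)
    (f := fun z => z.1.toList ++ z.2)
  have h7 := runs_bwt w
  rw [← hR] at h7
  omega

theorem card_prefixes_rotations_le {w : List α} {k : ℕ} (hk : k ≤ w.length) :
    ((rotations w).map (List.take k)).toFinset.card + k ≤ 1 + k * bwtRuns w := by
  induction k with
  | zero =>
    have : ((rotations w).map (List.take 0)).toFinset ⊆ {[]} := by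
      intro x
      simp
    have := Finset.card_le_card this
    simpa using this
  | succ k ih =>
    have h1 := ih (by omega)
    have h2 := card_prefixes_rotations_succ (w := w) (k := k) (by omega)
    rw [Nat.succ_mul]
    omega

theorem delta_le_bwtRuns (w : List α) : delta w ≤ bwtRuns w := by
  refine delta_le fun k hk hkw => ?_
  have h1 := card_prefixes_rotations_le hkw
  have h2 : substringCount w k ≤ ((rotations w).map (List.take k)).toFinset.card := by
    refine substringCount_le_of_subset _ fun i hi => ?_
    simp only [rotations, List.map_map, List.mem_toFinset, List.mem_map, List.mem_range,
      Function.comp_apply]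
    refine ⟨i, by omega, ?_⟩
    rw [List.rotate_eq_drop_append_take (by omega),
      List.take_append_of_le_length (by simp; omega)]
    rfl
  omega

end Runs

/-! ### Grammars -/

/-- An occurrence in a concatenation covers the first position of some part, or lies inside a
part. -/
theorem factor_flatten_cases {U : List (List α)} {i k : ℕ} (hk : 1 ≤ k)
    (hi : i + k ≤ U.flatten.length) :
    (∃ j < U.length, i ≤ (U.take j).flatten.length ∧ (U.take j).flatten.length < i + k) ∨
      ∃ x ∈ U, ∃ j, 1 ≤ j ∧ j + k ≤ x.length ∧ factor U.flatten i k = factor x j k := by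
  obtain ⟨l₁, x, l₂, rfl, h1, h2⟩ := exists_part_of_lt List.length U (p := i)
    (by rw [← List.length_flatten]; omega)
  rw [← List.length_flatten] at h1 h2
  rcases h1.eq_or_lt with h1 | h1
  · exact Or.inl ⟨l₁.length, by simp, by simp [h1], by simp [h1]; omega⟩
  rcases Nat.lt_or_ge (l₁.flatten.length + x.length) (i + k) with h3 | h3
  · have htake : (l₁ ++ x :: l₂).take (l₁.length + 1) = l₁ ++ [x] := by
      simp [List.take_append, List.take_of_length_le]
    have hlen : (l₁ ++ [x]).flatten.length = l₁.flatten.length + x.length := by simp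
    refine Or.inl ⟨l₁.length + 1, ?_, by rw [htake, hlen]; omega, by rw [htake, hlen]; omega⟩
    have : l₂ ≠ [] := by
      rintro rfl
      simp at hi
      simp at h3
      omega
    have := List.length_pos_iff.2 this
    simp
    omega
  · refine Or.inr ⟨x, by simp, i - l₁.flatten.length, by omega, by omega, ?_⟩
    rw [factor_eq_factor_iff]
    intro t ht
    rw [List.flatten_append, List.getElem?_append_right (by omega), List.flatten_cons,
      List.getElem?_append_left (by omega)]
    congr 1
    omega

theorem length_flatten_replicate (t : ℕ) (u : List α) :
    (List.replicate t u).flatten.length = t * u.length := by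
  simp

theorem getElem?_flatten_replicate {t i : ℕ} {u : List α} (h : i < t * u.length) :
    (List.replicate t u).flatten[i]? = u[i % u.length]? := by
  induction t generalizing i with
  | zero => simp at h
  | succ t ih =>
    rw [List.replicate_succ, List.flatten_cons]
    rcases Nat.lt_or_ge i u.length with hi | hi
    · rw [List.getElem?_append_left hi, Nat.mod_eq_of_lt hi]
    · rw [List.getElem?_append_right hi, ih (by rw [Nat.succ_mul] at h; omega),
        Nat.mod_eq_sub_mod hi]

/-- The substrings of length `k` of the word derived from a right-hand side are substrings of the
word of some nonterminal, up to at most `k` exceptions per unit of size. -/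
theorem Rhs.exists_exceptions {N : Type*} (ρ : Rhs α N) (f : N → List α) {k : ℕ} (hk : 1 ≤ k) :
    ∃ S : Finset (List α), S.card ≤ k * ρ.size ∧ ∀ i, i + k ≤ (ρ.eval f).length →
      factor (ρ.eval f) i k ∈ S ∨
        ∃ X j, j + k ≤ (f X).length ∧ factor (ρ.eval f) i k = factor (f X) j k := by
  classical
  cases ρ with
  | seq l =>
    set U := l.map (Sum.elim (fun c => [c]) f) with hU
    have hev : (Rhs.seq l).eval f = U.flatten := by rw [Rhs.eval, List.flatMap_def]
    rw [hev]
    refine ⟨(Finset.range U.length).biUnion fun j =>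
      (Finset.Icc ((U.take j).flatten.length + 1 - k) (U.take j).flatten.length).image
        fun q => factor U.flatten q k, ?_, fun i hi => ?_⟩
    · have hlen : (Finset.range U.length).card = (Rhs.seq l).size := by simp [hU, Rhs.size]
      rw [mul_comm, ← hlen]
      refine Finset.card_biUnion_le_card_mul _ _ _ fun p _ => Finset.card_image_le.trans ?_
      rw [Nat.card_Icc]
      omega
    · rcases factor_flatten_cases hk hi with ⟨j, hj, h1, h2⟩ | ⟨x, hx, j, h1, h2, h3⟩
      · refine Or.inl (Finset.mem_biUnion.2 ⟨j, Finset.mem_range.2 hj, ?_⟩)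
        exact Finset.mem_image_of_mem _ (Finset.mem_Icc.2 ⟨by omega, h1⟩)
      · obtain ⟨X, -, rfl⟩ := List.mem_map.1 hx
        cases X with
        | inl c => simp at h2; omega
        | inr X => exact Or.inr ⟨X, j, h2, h3⟩
  | power X t =>
    set u := Sum.elim (fun c => [c]) f X with hu
    have hev : (Rhs.power X t).eval f = (List.replicate t u).flatten := rfl
    rw [hev]
    -- by periodicity, an occurrence that covers the start of a copy of `u` is determined by the
    -- offset of that start, and may be moved near the `k`-th copy in a long enough power of `u`
    refine ⟨(Finset.range k).image fun e =>
      factor (List.replicate (2 * k) u).flatten (k * u.length - e) k, ?_, fun i hi => ?_⟩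
    · refine Finset.card_image_le.trans ?_
      rw [Finset.card_range]
      exact Nat.le_mul_of_pos_right k (by simp [Rhs.size])
    · rcases factor_flatten_cases hk hi with ⟨j, hj, h1, h2⟩ | ⟨x, hx, j, h1, h2, h3⟩
      · left
        rw [List.length_replicate] at hj
        rw [List.take_replicate, min_eq_left hj.le, length_flatten_replicate] at h1 h2
        rw [length_flatten_replicate] at hi
        have hu0 : 0 < u.length := by
          rcases Nat.eq_zero_or_pos u.length with h | h
          · rw [h, mul_zero] at hi
            omega
          · exact h
        have hku : k ≤ k * u.length := Nat.le_mul_of_pos_right k hu0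
        refine Finset.mem_image.2 ⟨j * u.length - i, Finset.mem_range.2 (by omega), ?_⟩
        rw [factor_eq_factor_iff]
        intro s hs
        rw [getElem?_flatten_replicate (by rw [mul_assoc, two_mul]; omega),
          getElem?_flatten_replicate (by omega)]
        congr 1
        refine Nat.ModEq.add_right _ (Nat.ModEq.add_right_cancel' (j * u.length - i) ?_)
        rw [Nat.sub_add_cancel (by omega), Nat.add_sub_cancel' h1]
        simp [Nat.ModEq]
      · right
        rw [List.eq_of_mem_replicate hx] at h2 h3
        rcases X with c | X
        · simp [hu] at h2
          omega
        · exact ⟨X, j, h2, h3⟩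

theorem Grammar.substringCount_word_le (G : Grammar α) {k : ℕ} (hk : 1 ≤ k) :
    substringCount G.word k ≤ k * G.size := by
  classical
  have : ∀ i : Fin (G.m + 1), ∃ S : Finset (List α), S.card ≤ k * (G.rule i).size ∧
      ∀ p, p + k ≤ (G.expand i.1 i.2).length → factor (G.expand i.1 i.2) p k ∈ S ∨
        ∃ X : Fin i, ∃ j, j + k ≤ (G.expand X.1 (X.2.trans i.2)).length ∧
          factor (G.expand i.1 i.2) p k = factor (G.expand X.1 (X.2.trans i.2)) j k := by
    intro i
    rw [Grammar.expand]
    exact Rhs.exists_exceptions (G.rule i) _ hk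
  choose S hcard hS using this
  have hmem : ∀ i : ℕ, ∀ hi : i < G.m + 1, ∀ p, p + k ≤ (G.expand i hi).length →
      factor (G.expand i hi) p k ∈ Finset.univ.biUnion S := by
    intro i
    induction i using Nat.strong_induction_on with
    | _ i ih =>
      intro hi p hp
      rcases hS ⟨i, hi⟩ p hp with h | ⟨X, j, hj, h⟩
      · exact Finset.mem_biUnion.2 ⟨_, Finset.mem_univ _, h⟩
      · rw [h]
        exact ih X.1 X.2 _ j hj
  refine (substringCount_le_of_subset _ (hmem G.m (Nat.lt_succ_self _))).trans ?_
  refine Finset.card_biUnion_le.trans ?_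
  rw [Grammar.size, Finset.mul_sum]
  exact Finset.sum_le_sum fun i _ => hcard i

theorem exists_isPlain_grammar (w : List α) : ∃ G : Grammar α, G.IsPlain ∧ G.word = w := by
  refine ⟨⟨0, fun _ => Rhs.seq (w.map Sum.inl)⟩, fun i => ⟨_, rfl⟩, ?_⟩
  rw [Grammar.word, Grammar.expand, Rhs.eval, List.flatMap_map]
  exact List.flatMap_singleton' w

theorem delta_le_rlGrammarSize (w : List α) : delta w ≤ rlGrammarSize w := by
  obtain ⟨G₀, -, h₀⟩ := exists_isPlain_grammar w
  obtain ⟨G, hG, hs⟩ := Nat.sInf_mem (s := {s | ∃ G : Grammar α, G.word = w ∧ G.size = s})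
    ⟨_, G₀, h₀, rfl⟩
  refine delta_le fun k hk _ => ?_
  rw [rlGrammarSize, ← hs, ← hG]
  exact G.substringCount_word_le hk

theorem rlGrammarSize_le_grammarSize (w : List α) : rlGrammarSize w ≤ grammarSize w := by
  obtain ⟨G₀, hp, h₀⟩ := exists_isPlain_grammar w
  obtain ⟨G, -, hG, hs⟩ := Nat.sInf_mem
    (s := {s | ∃ G : Grammar α, G.IsPlain ∧ G.word = w ∧ G.size = s}) ⟨_, G₀, hp, h₀, rfl⟩
  exact Nat.sInf_le ⟨G, hG, hs⟩

/-! ### Combinatorics of Fibonacci words -/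

theorem length_fibWord (a b : α) (k : ℕ) : (fibWord a b k).length = Nat.fib (k + 1) := by
  induction k using Nat.twoStepInduction with
  | zero => rfl
  | one => rfl
  | more k h1 h2 => rw [fibWord, List.length_append, h1, h2, Nat.fib_add_two (n := k + 1), add_comm]

theorem mem_fibWord {a b c : α} {k : ℕ} (h : c ∈ fibWord a b k) : c = a ∨ c = b := by
  induction k using Nat.twoStepInduction with
  | zero => exact Or.inr (by simpa [fibWord] using h)
  | one => exact Or.inl (by simpa [fibWord] using h)
  | more k h1 h2 =>
    rw [fibWord, List.mem_append] at h
    exact h.elim h2 h1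

theorem fibWord_prefix_fibWord (a b : α) {i k : ℕ} (hik : i ≤ k) :
    fibWord a b (i + 1) <+: fibWord a b (k + 1) := by
  induction k, hik using Nat.le_induction with
  | base => exact List.prefix_refl _
  | succ k _ ih => exact ih.trans (List.prefix_append _ _)

/-- Consecutive Fibonacci words commute up to their last two symbols. -/
theorem fibWord_append_comm (a b : α) (k : ℕ) : ∃ P x y, (x = a ∧ y = b ∨ x = b ∧ y = a) ∧
    fibWord a b (k + 1) ++ fibWord a b k = P ++ [x, y] ∧
    fibWord a b k ++ fibWord a b (k + 1) = P ++ [y, x] := by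
  induction k with
  | zero => exact ⟨[], a, b, by simp, rfl, rfl⟩
  | succ k ih =>
    obtain ⟨P, x, y, hxy, h1, h2⟩ := ih
    refine ⟨fibWord a b (k + 1) ++ P, y, x, hxy.symm.imp And.symm And.symm, ?_, ?_⟩
    · rw [fibWord, List.append_assoc, h2, List.append_assoc]
    · rw [show fibWord a b (k + 1 + 1) = fibWord a b (k + 1) ++ fibWord a b k from rfl, h1,
        List.append_assoc]

section Substitution

variable [DecidableEq α]

/-- The Fibonacci substitution `a ↦ ab`, `b ↦ a`. -/
def fibSubst (a b c : α) : List α := if c = a then [a, b] else [a]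

theorem fibWord_succ_eq_flatMap {a b : α} (hab : a ≠ b) (k : ℕ) :
    fibWord a b (k + 1) = (fibWord a b k).flatMap (fibSubst a b) := by
  induction k using Nat.twoStepInduction with
  | zero => simp [fibWord, fibSubst, hab.symm]
  | one => simp [fibWord, fibSubst]
  | more k h1 h2 =>
    change _ = (fibWord a b (k + 1) ++ fibWord a b k).flatMap _
    rw [List.flatMap_append, ← h1, ← h2, fibWord]

theorem not_bb_infix_flatMap {a b : α} (hab : a ≠ b) (u : List α) :
    ¬ [b, b] <:+: u.flatMap (fibSubst a b) := by
  have hpre : ∀ u : List α, ¬ [b] <+: u.flatMap (fibSubst a b) := by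
    intro u
    cases u with
    | nil => simp
    | cons c u =>
      simp only [List.flatMap_cons, fibSubst]
      split_ifs <;> simp [List.cons_prefix_cons, hab.symm]
  induction u with
  | nil => simp
  | cons c u ih =>
    simp only [List.flatMap_cons, fibSubst]
    split_ifs
    · simp only [List.cons_append, List.nil_append, List.infix_cons_iff, List.cons_prefix_cons,
        hab.symm, false_and, true_and, false_or, not_or]
      exact ⟨hpre u, ih⟩
    · simp only [List.cons_append, List.nil_append, List.infix_cons_iff, List.cons_prefix_cons,
        hab.symm, false_and, false_or]
      exact ih

theorem not_aaa_infix_flatMap {a b : α} (hab : a ≠ b) {u : List α} (hu : ∀ c ∈ u, c = a ∨ c = b)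
    (hbb : ¬ [b, b] <:+: u) : ¬ [a, a, a] <:+: u.flatMap (fibSubst a b) := by
  induction u with
  | nil => simp
  | cons c u ih =>
    rw [List.infix_cons_iff, not_or] at hbb
    have ih := ih (fun c hc => hu c (List.mem_cons_of_mem _ hc)) hbb.2
    simp only [List.flatMap_cons, fibSubst]
    split_ifs with hc
    · simp only [List.cons_append, List.nil_append, List.infix_cons_iff, List.cons_prefix_cons,
        hab, false_and, false_or, and_false]
      exact ih
    · obtain rfl : c = b := (hu c (by simp)).resolve_left hc
      simp only [List.cons_append, List.nil_append, List.infix_cons_iff, List.cons_prefix_cons,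
        true_and, not_or]
      refine ⟨?_, ih⟩
      cases u with
      | nil => simp
      | cons d u =>
        have hd : d ≠ c := by
          rintro rfl
          exact hbb.1 (by simp [List.cons_prefix_cons])
        obtain rfl : d = a := (hu d (by simp)).resolve_right hd
        simp [fibSubst, List.cons_prefix_cons, hab]

end Substitution

theorem not_bb_infix_fibWord {a b : α} (hab : a ≠ b) (k : ℕ) : ¬ [b, b] <:+: fibWord a b k := by
  classical
  cases k with
  | zero =>
    intro h
    simpa [fibWord] using h.length_le
  | succ k =>
    rw [fibWord_succ_eq_flatMap hab]
    exact not_bb_infix_flatMap hab _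

theorem not_aaa_infix_fibWord {a b : α} (hab : a ≠ b) (k : ℕ) :
    ¬ [a, a, a] <:+: fibWord a b k := by
  classical
  cases k with
  | zero =>
    intro h
    simpa [fibWord] using h.length_le
  | succ k =>
    rw [fibWord_succ_eq_flatMap hab]
    exact not_aaa_infix_flatMap hab (fun c hc => mem_fibWord hc) (not_bb_infix_fibWord hab k)

/-! ### Grammars and LZ77 for Fibonacci words -/

/-- The grammar of `fibWord a b k` whose nonterminal `i` derives the `i`-th Fibonacci word. -/
def fibGrammar (a b : α) (k : ℕ) : Grammar α where
  m := k
  rule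
    | ⟨0, _⟩ => Rhs.seq [Sum.inl b]
    | ⟨1, _⟩ => Rhs.seq [Sum.inl a]
    | ⟨i + 2, _⟩ => Rhs.seq [Sum.inr ⟨i + 1, by simp⟩, Sum.inr ⟨i, by simp⟩]

theorem expand_fibGrammar (a b : α) (k i : ℕ) (hi : i < (fibGrammar a b k).m + 1) :
    (fibGrammar a b k).expand i hi = fibWord a b i := by
  induction i using Nat.strong_induction_on with
  | _ i ih =>
    rw [Grammar.expand]
    match i, hi, ih with
    | 0, _, _ => rfl
    | 1, _, _ => rfl
    | i + 2, hi, ih =>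
      have h1 := ih (i + 1) (by omega) (by omega)
      have h2 := ih i (by omega) (by omega)
      simp only [fibGrammar, Rhs.eval, List.flatMap_cons, List.flatMap_nil, Sum.elim_inr,
        List.append_nil] at h1 h2 ⊢
      rw [h1, h2, fibWord]

theorem grammarSize_fibWord_le (a b : α) (k : ℕ) : grammarSize (fibWord a b k) ≤ 2 * (k + 1) := by
  have hsize : ∀ i, ((fibGrammar a b k).rule i).size ≤ 2 := by
    rintro ⟨i, hi⟩
    match i, hi with
    | 0, _ => exact Nat.le_succ 1
    | 1, _ => exact Nat.le_succ 1
    | i + 2, _ => exact le_rfl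
  have hplain : (fibGrammar a b k).IsPlain := by
    rintro ⟨i, hi⟩
    match i, hi with
    | 0, _ => exact ⟨_, rfl⟩
    | 1, _ => exact ⟨_, rfl⟩
    | i + 2, _ => exact ⟨_, rfl⟩
  refine (Nat.sInf_le (⟨fibGrammar a b k, hplain, expand_fibGrammar a b k k _, rfl⟩ :
    _ ∈ {s | ∃ G : Grammar α, G.IsPlain ∧ G.word = fibWord a b k ∧ G.size = s})).trans ?_
  refine (Finset.sum_le_card_nsmul _ _ 2 fun i _ => hsize i).trans ?_
  rw [Finset.card_univ, Fintype.card_fin, smul_eq_mul, mul_comm]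
  exact le_rfl

theorem factor_zero_of_prefix {u w : List α} (h : u <+: w) : factor w 0 u.length = u := by
  obtain ⟨v, rfl⟩ := h
  simp [factor]

theorem lzSize_fibWord_le (a b : α) (k : ℕ) : lzSize (fibWord a b (k + 1)) ≤ k + 1 := by
  set w := fibWord a b (k + 1) with hw
  have hmono := monotone_greedy_end (lzMatch_le_succ w)
  have key : ∀ i ≤ k, lzSize w ≤
      greedyCount w.length (lzMatch w) (fibWord a b (i + 1)).length + (i + 1) := by
    intro i
    induction i with
    | zero =>
      intro _
      exact greedyCount_le_succ hmono (by simp [fibWord])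
    | succ i ih =>
      intro hi
      refine (ih (by omega)).trans ?_
      rw [← add_assoc _ (i + 1) 1, add_right_comm]
      refine Nat.add_le_add_right (greedyCount_le_succ hmono ?_) _
      rw [fibWord, List.length_append]
      refine Nat.add_le_add_left ?_ _
      rcases Nat.eq_zero_or_eq_succ_pred i with rfl | hi'
      · exact le_max_left _ _
      · -- the phrase is a shorter Fibonacci word, which is also a prefix of `w`
        refine (le_lzMatch (j := 0) ?_ ?_ ?_).trans (le_max_right _ _)
        · have := (fibWord_prefix_fibWord a b hi).length_le
          rwa [fibWord, List.length_append] at this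
        · rw [length_fibWord]
          exact Nat.fib_pos.2 (by omega)
        · have hpre : fibWord a b i <+: w := by
            rw [hi']
            exact fibWord_prefix_fibWord a b (by simp only [Nat.pred_eq_sub_one]; omega)
          rw [factor_zero_of_prefix hpre]
          obtain ⟨v, hv⟩ := fibWord_prefix_fibWord a b hi
          rw [hw, ← hv, fibWord]
          simp [factor]
  have := key k le_rfl
  rwa [greedyCount_of_le _ le_rfl, zero_add] at this

/-! ### The lex-parse and the Burrows-Wheeler transform of Fibonacci words -/

theorem getElem?_rotate_add {w : List α} (hw : 0 < w.length) (f i : ℕ) :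
    (w.rotate f)[i % w.length]? = w[(i + f) % w.length]? := by
  have h1 : i % w.length < w.length := Nat.mod_lt _ hw
  have h2 : (i + f) % w.length < w.length := Nat.mod_lt _ hw
  rw [List.getElem?_eq_getElem (by simpa using h1), List.getElem?_eq_getElem h2,
    List.getElem_rotate]
  simp

/-- If rotating by `f` swaps the last two symbols, all other symbols are repeated at cyclic distance
`f`. -/
theorem getElem?_add_of_swap {w P : List α} {x y : α} {f : ℕ} (hw : w = P ++ [x, y])
    (hf : w.rotate f = P ++ [y, x]) {i : ℕ} (hi : i % w.length < P.length) :
    w[i % w.length]? = w[(i + f) % w.length]? := by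
  rw [← getElem?_rotate_add (by simp [hw]) f i, hf, List.getElem?_append_left hi]
  nth_rewrite 1 [hw]
  rw [List.getElem?_append_left hi]

theorem runs_map_range_le {β : Type*} [DecidableEq β] (g : ℕ → β) (m : ℕ) :
    runs ((List.range (m + 1)).map g) ≤
      1 + (List.range m).countP fun i => decide (g i ≠ g (i + 1)) := by
  induction m generalizing g with
  | zero => simp [runs_singleton]
  | succ m ih =>
    have ih := ih (g ∘ Nat.succ)
    rw [List.range_succ_eq_map, List.map_cons, List.map_map] at ih
    rw [List.range_succ_eq_map, List.map_cons, List.map_map, List.range_succ_eq_map, List.map_cons,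
      runs_cons_cons, List.countP_cons, List.countP_map]
    simp only [List.map_map, Function.comp_def, Nat.succ_eq_add_one, zero_add,
      decide_eq_true_eq] at ih ⊢
    split_ifs <;> omega

theorem getLast?_rotate_succ {w : List α} (hw : 0 < w.length) (i : ℕ) :
    (w.rotate (i + 1)).getLast? = w[i % w.length]? := by
  rw [← List.rotate_rotate, getLast?_rotate_one, List.head?_eq_getElem?]
  have := getElem?_rotate_add hw i 0
  simpa using this

theorem fibWord_swap {a b : α} (hab : a ≠ b) (k : ℕ) : ∃ P x y, x ≠ y ∧
    fibWord a b (k + 2) = P ++ [x, y] ∧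
    (fibWord a b (k + 2)).rotate (fibWord a b (k + 1)).length = P ++ [y, x] := by
  obtain ⟨P, x, y, hxy, h1, h2⟩ := fibWord_append_comm a b k
  refine ⟨P, x, y, ?_, h1, ?_⟩
  · rcases hxy with ⟨rfl, rfl⟩ | ⟨rfl, rfl⟩
    exacts [hab, hab.symm]
  · rw [fibWord, List.rotate_append_length_eq, h2]

section Swap

variable [LinearOrder α]

theorem rotate_lt_rotate_swap {P : List α} {x y : α} (hxy : x < y) {p : ℕ} (hp : p ≤ P.length) :
    (P ++ [x, y]).rotate p < (P ++ [y, x]).rotate p := by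
  rw [List.rotate_eq_drop_append_take (by simp; omega),
    List.rotate_eq_drop_append_take (by simp; omega), List.drop_append_of_le_length hp,
    List.take_append_of_le_length hp, List.drop_append_of_le_length hp,
    List.take_append_of_le_length hp, List.append_assoc, List.append_assoc,
    append_lt_append_left_iff]
  simp [List.cons_lt_cons_iff, hxy]

/-- If rotating by `f` swaps the last two symbols, the lex-parse has at most four phrases: apart
from two symbols, the sources can be chosen at a constant cyclic distance. -/
theorem lexSize_le_four_of_swap {w P : List α} {x y : α} {f : ℕ} (hw : w = P ++ [x, y])
    (hf : w.rotate f = P ++ [y, x]) (hxy : x ≠ y) (hfw : f < w.length) (hwf : w.length ≤ 2 * f) :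
    lexSize w ≤ 4 := by
  have hlen : w.length = P.length + 2 := by simp [hw]
  have hmono := monotone_greedy_end (lexMatch_le_succ w)
  have hend : greedyCount w.length (lexMatch w) w.length = 0 := greedyCount_of_le _ le_rfl
  -- the two occurrences of the common part of `w` and its rotation
  have hA : ∀ l, l + f ≤ w.length → l ≤ P.length → factor w 0 l = factor w f l := by
    intro l h1 h2
    rw [factor_eq_factor_iff]
    intro t ht
    have := getElem?_add_of_swap hw hf (i := t) (by rw [Nat.mod_eq_of_lt (by omega)]; omega)
    rw [Nat.mod_eq_of_lt (by omega), Nat.mod_eq_of_lt (by omega)] at this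
    rw [zero_add, this, add_comm]
  have hB : ∀ l, l + 2 ≤ f → factor w (w.length - f) l = factor w 0 l := by
    intro l h1
    rw [factor_eq_factor_iff]
    intro t ht
    have := getElem?_add_of_swap hw hf (i := w.length - f + t)
      (by rw [Nat.mod_eq_of_lt (by omega)]; omega)
    rw [Nat.mod_eq_of_lt (by omega),
      show w.length - f + t + f = t + w.length by omega, Nat.add_mod_right,
      Nat.mod_eq_of_lt (by omega)] at this
    rw [zero_add, this]
  have hrotB : (w.rotate f).rotate (w.length - f) = w.rotate 0 := by
    rw [List.rotate_rotate, Nat.add_sub_cancel' hfw.le, List.rotate_length, List.rotate_zero]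
  rcases lt_or_gt_of_ne hxy with h | h
  · have hrot : ∀ p ≤ P.length, w.rotate p < (w.rotate f).rotate p := by
      intro p hp
      rw [hf, hw]
      exact rotate_lt_rotate_swap h hp
    have h1 : greedyCount w.length (lexMatch w) 0 ≤
        greedyCount w.length (lexMatch w) (f - 2) + 1 := by
      refine greedyCount_le_succ hmono ?_
      rcases Nat.lt_or_ge f 4 with h4 | h4
      · omega
      · have := le_lexMatch (w := w) (p := 0) (l := f - 2) (j := w.length - f) (by omega) (by omega)
          (by omega) (by rw [← hrotB]; exact hrot _ (by omega)) (hB _ (by omega))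
        omega
    have h2 : greedyCount w.length (lexMatch w) (f - 2) ≤
        greedyCount w.length (lexMatch w) (f - 1) + 1 := greedyCount_le_succ hmono (by omega)
    have h3 : greedyCount w.length (lexMatch w) (f - 1) ≤
        greedyCount w.length (lexMatch w) f + 1 := greedyCount_le_succ hmono (by omega)
    have h4 : greedyCount w.length (lexMatch w) f ≤
        greedyCount w.length (lexMatch w) w.length + 1 := by
      refine greedyCount_le_succ hmono ?_
      rcases Nat.lt_or_ge f 2 with h4 | h4
      · omega
      · have := le_lexMatch (w := w) (p := f) (l := w.length - f) (j := 0) (by omega) (by omega)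
          (by omega) (by simpa using hrot 0 (Nat.zero_le _)) (hA _ (by omega) (by omega))
        omega
    unfold lexSize
    omega
  · have hrot : ∀ p ≤ P.length, (w.rotate f).rotate p < w.rotate p := by
      intro p hp
      rw [hf, hw]
      exact rotate_lt_rotate_swap h hp
    have h1 : greedyCount w.length (lexMatch w) 0 ≤
        greedyCount w.length (lexMatch w) (w.length - f) + 1 := by
      refine greedyCount_le_succ hmono ?_
      rcases Nat.lt_or_ge f 2 with h4 | h4
      · omega
      · have := le_lexMatch (w := w) (p := 0) (l := w.length - f) (j := f) (by omega) (by omega)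
          (by omega) (by simpa using hrot 0 (Nat.zero_le _)) (hA _ (by omega) (by omega)).symm
        omega
    have h2 : greedyCount w.length (lexMatch w) (w.length - f) ≤
        greedyCount w.length (lexMatch w) (w.length - 2) + 1 := by
      refine greedyCount_le_succ hmono ?_
      rcases Nat.lt_or_ge f 4 with h4 | h4
      · omega
      · have := le_lexMatch (w := w) (p := w.length - f) (l := f - 2) (j := 0) (by omega) (by omega)
          (by omega) (by rw [← hrotB]; exact hrot _ (by omega)) (hB _ (by omega)).symm
        omega
    have h3 : greedyCount w.length (lexMatch w) (w.length - 2) ≤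
        greedyCount w.length (lexMatch w) (w.length - 1) + 1 := greedyCount_le_succ hmono (by omega)
    have h4 : greedyCount w.length (lexMatch w) (w.length - 1) ≤
        greedyCount w.length (lexMatch w) w.length + 1 := greedyCount_le_succ hmono (by omega)
    unfold lexSize
    omega

/-- The sorted rotations, if they are visited by steps of constant cyclic length. -/
theorem insertionSort_rotations_eq {w : List α} {p s : ℕ} (hs : Nat.Coprime w.length s)
    (hle : ∀ i, i + 1 < w.length → w.rotate (p + i * s) ≤ w.rotate (p + (i + 1) * s)) :
    (rotations w).insertionSort (· ≤ ·) =
      (List.range w.length).map fun i => w.rotate (p + i * s) := by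
  have hperm : ((List.range w.length).map fun i => w.rotate (p + i * s)).Perm (rotations w) := by
    have h1 : ((List.range w.length).map fun i => w.rotate (p + i * s)) =
        ((List.range w.length).map fun i => (p + i * s) % w.length).map fun i => w.rotate i := by
      rw [List.map_map]
      refine List.map_congr_left fun i _ => ?_
      simp [List.rotate_mod]
    rw [h1]
    refine List.Perm.map _ ?_
    refine (List.subperm_of_subset ?_ ?_).perm_of_length_le (by simp)
    · refine List.Nodup.map_on ?_ List.nodup_range
      intro i hi j hj hij
      rw [List.mem_range] at hi hj
      have h2 : i * s ≡ j * s [MOD w.length] := Nat.ModEq.add_left_cancel' p hij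
      exact (Nat.ModEq.cancel_right_of_coprime hs h2).eq_of_lt_of_lt hi hj
    · intro i hi
      obtain ⟨j, hj, rfl⟩ := List.mem_map.1 hi
      rw [List.mem_range] at hj ⊢
      exact Nat.mod_lt _ (by omega)
  refine List.Perm.eq_of_pairwise' (r := (· ≤ ·)) (List.pairwise_insertionSort _ _) ?_
    ((List.perm_insertionSort _ _).trans hperm.symm)
  rw [List.pairwise_map]
  have hmono : ∀ i j, i ≤ j → j < w.length → w.rotate (p + i * s) ≤ w.rotate (p + j * s) := by
    intro i j hij
    induction j, hij using Nat.le_induction with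
    | base => exact fun _ => le_rfl
    | succ j _ ih => exact fun h => (ih (by omega)).trans (hle j h)
  exact List.pairwise_lt_range.imp_of_mem fun _ hj h => hmono _ _ h.le (List.mem_range.1 hj)

theorem bwtRuns_le_two {w : List α} {p s : ℕ} (hw : 0 < w.length) (hs : Nat.Coprime w.length s)
    (hle : ∀ i, i + 1 < w.length → w.rotate (p + 1 + i * s) ≤ w.rotate (p + 1 + (i + 1) * s))
    (hsymb : ∀ i, i + 1 < w.length → ¬ (i + 1) * s ≡ 1 [MOD w.length] →
      w[(p + i * s) % w.length]? = w[(p + (i + 1) * s) % w.length]?) : bwtRuns w ≤ 2 := by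
  have hmap : (List.range w.length).map (List.getLast? ∘ fun i => w.rotate (p + 1 + i * s)) =
      (List.range w.length).map fun i => w[(p + i * s) % w.length]? := by
    refine List.map_congr_left fun i _ => ?_
    rw [Function.comp_apply, add_right_comm, getLast?_rotate_succ hw]
  rw [← runs_bwt, insertionSort_rotations_eq hs hle, List.map_map, hmap]
  obtain ⟨m, hm⟩ := Nat.exists_eq_add_of_le' hw
  have hruns := runs_map_range_le (fun i => w[(p + i * s) % w.length]?) m
  rw [← hm] at hruns
  refine hruns.trans (Nat.add_le_add_left (m := 1) ?_ 1)
  by_cases hbad : ∃ i₀, i₀ + 1 < w.length ∧ (i₀ + 1) * s ≡ 1 [MOD w.length]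
  · obtain ⟨i₀, hi₀, h₀⟩ := hbad
    refine (List.countP_mono_left (q := fun i => i == i₀) ?_).trans
      (List.nodup_iff_count_le_one.1 List.nodup_range i₀)
    intro i hi hne
    rw [List.mem_range] at hi
    have hi' : (i + 1) * s ≡ 1 [MOD w.length] := by
      by_contra hc
      exact (of_decide_eq_true hne) (hsymb i (by omega) hc)
    have := (Nat.ModEq.cancel_right_of_coprime hs (hi'.trans h₀.symm)).eq_of_lt_of_lt
      (by omega) hi₀
    rw [beq_iff_eq]
    omega
  · refine le_of_eq_of_le (List.countP_eq_zero.2 fun i hi hne => ?_) (Nat.zero_le 1)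
    rw [List.mem_range] at hi
    exact (of_decide_eq_true hne) (hsymb i (by omega) fun h => hbad ⟨i, by omega, h⟩)

/-- If rotating by `f` swaps the last two symbols, sorting the rotations amounts to repeated
rotation by `f` or by `-f`, and the transform has at most two runs. -/
theorem bwtRuns_le_two_of_swap {w P : List α} {x y : α} {f : ℕ} (hw : w = P ++ [x, y])
    (hf : w.rotate f = P ++ [y, x]) (hxy : x ≠ y) (hfw : f < w.length)
    (hco : Nat.Coprime w.length f) : bwtRuns w ≤ 2 := by
  have hlen : w.length = P.length + 2 := by simp [hw]
  have hlast : ∀ {s i : ℕ}, Nat.Coprime w.length s → i + 1 < w.length →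
      ¬ w.length ∣ (i + 1) * s := by
    intro s i hs hi hd
    exact absurd (Nat.le_of_dvd (by omega) (hs.dvd_of_dvd_mul_right hd)) (by omega)
  have hmodP : ∀ {s i : ℕ}, Nat.Coprime w.length s → i + 1 < w.length →
      ¬ (i + 1) * s ≡ 1 [MOD w.length] → (P.length + (i + 1) * s) % w.length < P.length := by
    intro s i hs hi h
    have h1 := hlast hs hi
    rw [Nat.dvd_iff_mod_eq_zero] at h1
    have h2 : (i + 1) * s % w.length ≠ 1 := by
      intro h2
      exact h (by rw [Nat.ModEq, h2, Nat.mod_eq_of_lt (by omega)])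
    have h3 := Nat.mod_lt ((i + 1) * s) (show 0 < w.length by omega)
    rw [Nat.add_mod, Nat.mod_eq_of_lt (show P.length < w.length by omega),
      Nat.mod_eq_sub_mod (by omega), Nat.mod_eq_of_lt (by omega)]
    omega
  have hmodle : ∀ {s i : ℕ}, Nat.Coprime w.length s → i + 1 < w.length →
      (P.length + 1 + (i + 1) * s) % w.length ≤ P.length := by
    intro s i hs hi
    have h1 := hlast hs hi
    rw [Nat.dvd_iff_mod_eq_zero] at h1
    have h3 := Nat.mod_lt ((i + 1) * s) (show 0 < w.length by omega)
    rw [Nat.add_mod, Nat.mod_eq_of_lt (show P.length + 1 < w.length by omega),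
      Nat.mod_eq_sub_mod (by omega), Nat.mod_eq_of_lt (by omega)]
    omega
  have hrot : ∀ m, (w.rotate f).rotate (m % w.length) = w.rotate (m + f) := by
    intro m
    rw [← List.length_rotate w f, List.rotate_mod, List.rotate_rotate, add_comm]
  rcases lt_or_gt_of_ne hxy with h | h
  · have h1 : ∀ i, P.length + f + i * f = P.length + (i + 1) * f := fun i => by ring
    refine bwtRuns_le_two (p := P.length + f) (s := f) (by omega) hco (fun i hi => ?_)
      fun i hi h' => ?_
    · have := rotate_lt_rotate_swap h (hmodle hco hi)
      rw [← hf, ← hw, hrot, List.rotate_mod] at this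
      rw [add_right_comm, h1, add_right_comm _ 1, h1, Nat.succ_mul (i + 1), ← add_assoc,
        add_right_comm, add_right_comm _ f 1, add_right_comm P.length ((i + 1) * f) 1]
      exact this.le
    · have := getElem?_add_of_swap hw hf (hmodP hco hi h')
      rw [h1, h1, Nat.succ_mul (i + 1), ← add_assoc]
      exact this
  · have hco' : Nat.Coprime w.length (w.length - f) := (Nat.coprime_self_sub_right hfw.le).2 hco
    have hadd : ∀ i, P.length + (i + 1) * (w.length - f) + f =
        P.length + i * (w.length - f) + w.length := by
      intro i
      rw [Nat.succ_mul]
      omega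
    refine bwtRuns_le_two (p := P.length) (s := w.length - f) (by omega) hco' (fun i hi => ?_)
      fun i hi h' => ?_
    · have := rotate_lt_rotate_swap h (hmodle hco' hi)
      rw [← hf, ← hw, hrot, List.rotate_mod, add_right_comm _ 1, add_right_comm _ 1, hadd,
        add_right_comm _ _ 1, ← List.rotate_mod, Nat.add_mod_right, List.rotate_mod,
        add_right_comm _ _ 1, add_right_comm _ _ 1] at this
      exact this.le
    · have := getElem?_add_of_swap hw hf (hmodP hco' hi h')
      rw [hadd, Nat.add_mod_right] at this
      exact this.symm

theorem lexSize_fibWord_le {a b : α} (hab : a ≠ b) (k : ℕ) : lexSize (fibWord a b (k + 2)) ≤ 4 := by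
  obtain ⟨P, x, y, hxy, h1, h2⟩ := fibWord_swap hab k
  have h3 : 0 < Nat.fib (k + 1) := Nat.fib_pos.2 (by omega)
  have h4 : Nat.fib (k + 2 + 1) = Nat.fib (k + 1) + Nat.fib (k + 1 + 1) := Nat.fib_add_two
  have h5 : Nat.fib (k + 1) ≤ Nat.fib (k + 1 + 1) := Nat.fib_le_fib_succ
  refine lexSize_le_four_of_swap h1 h2 hxy ?_ ?_ <;> rw [length_fibWord, length_fibWord] <;> omega

theorem bwtRuns_fibWord_le {a b : α} (hab : a ≠ b) (k : ℕ) : bwtRuns (fibWord a b (k + 2)) ≤ 2 := by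
  obtain ⟨P, x, y, hxy, h1, h2⟩ := fibWord_swap hab k
  have h3 : 0 < Nat.fib (k + 1) := Nat.fib_pos.2 (by omega)
  have h4 : Nat.fib (k + 2 + 1) = Nat.fib (k + 1) + Nat.fib (k + 1 + 1) := Nat.fib_add_two
  refine bwtRuns_le_two_of_swap h1 h2 hxy ?_ ?_ <;> rw [length_fibWord, length_fibWord]
  · omega
  · exact (Nat.fib_coprime_fib_succ (k + 2)).symm

end Swap

/-! ### Prefixes of infinite periodic words -/

/-- A symbol that may be absent, as an element of the alphabet with a bottom: the identity, which
makes the change of type in `omegaPower` explicit. -/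
def optionToBot (o : Option α) : WithBot α := o

/-- The first `k` symbols of `y^∞`. -/
def omegaPrefix (k : ℕ) (y : List α) : List (WithBot α) :=
  (List.range k).map (ofLex (omegaPower y))

theorem length_omegaPrefix (k : ℕ) (y : List α) : (omegaPrefix k y).length = k := by
  simp [omegaPrefix]

theorem getElem?_omegaPrefix {k i : ℕ} (hi : i < k) (y : List α) :
    (omegaPrefix k y)[i]? = some (optionToBot y[i % y.length]?) := by
  simp only [omegaPrefix, List.getElem?_map, List.getElem?_range hi, Option.map_some]
  rfl

theorem omegaPrefix_succ {y : List α} (hy : 0 < y.length) (k : ℕ) :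
    omegaPrefix (k + 1) y =
      optionToBot (y.rotate 1).getLast? :: omegaPrefix k (y.rotate 1) := by
  apply List.ext_getElem?
  intro i
  cases i with
  | zero =>
    rw [getElem?_omegaPrefix (Nat.succ_pos k), List.getElem?_cons_zero, getLast?_rotate_one,
      List.head?_eq_getElem?, Nat.zero_mod]
  | succ i =>
    rw [List.getElem?_cons_succ]
    rcases Nat.lt_or_ge i k with hi | hi
    · rw [getElem?_omegaPrefix (Nat.succ_lt_succ hi), getElem?_omegaPrefix hi, List.length_rotate,
        getElem?_rotate_add hy]
    · rw [List.getElem?_eq_none (by rw [length_omegaPrefix]; omega),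
        List.getElem?_eq_none (by rw [length_omegaPrefix]; omega)]

/-! ### Lyndon factorizations -/

theorem not_prefix_drop {v : List α} {t : ℕ} (h0 : 0 < t) (ht : t < v.length) :
    ¬ v <+: v.drop t := by
  intro hp
  have := hp.length_le
  rw [List.length_drop] at this
  omega

/-- The factor `v` of the factorization `F` starts at position `q` of the concatenation of `F`. -/
def HasFactorAt (F : List (List α)) (q : ℕ) (v : List α) : Prop :=
  ∃ l₁ l₂, F = l₁ ++ v :: l₂ ∧ l₁.flatten.length = q

section HasFactorAt

variable {F : List (List α)} {q : ℕ} {v : List α}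

theorem HasFactorAt.mem (h : HasFactorAt F q v) : v ∈ F := by
  obtain ⟨l₁, l₂, rfl, -⟩ := h
  simp

theorem HasFactorAt.getElem? (h : HasFactorAt F q v) {i : ℕ} (hi : i < v.length) :
    F.flatten[q + i]? = v[i]? := by
  obtain ⟨l₁, l₂, rfl, rfl⟩ := h
  rw [List.flatten_append, List.flatten_cons, List.getElem?_append_right (by omega),
    Nat.add_sub_cancel_left, List.getElem?_append_left hi]

theorem exists_hasFactorAt {p : ℕ} (hp : p < F.flatten.length) :
    ∃ q v, HasFactorAt F q v ∧ q ≤ p ∧ p < q + v.length := by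
  rw [List.length_flatten] at hp
  obtain ⟨l₁, v, l₂, hF, h1, h2⟩ := exists_part_of_lt List.length F hp
  rw [← List.length_flatten] at h1 h2
  exact ⟨_, v, ⟨l₁, l₂, hF, rfl⟩, h1, h2⟩

theorem HasFactorAt.next (h : HasFactorAt F q v) (hq : q + v.length < F.flatten.length) :
    ∃ v', HasFactorAt F (q + v.length) v' := by
  obtain ⟨l₁, l₂, rfl, rfl⟩ := h
  cases l₂ with
  | nil => simp at hq
  | cons v' l₂ => exact ⟨v', l₁ ++ [v], l₂, by simp, by simp⟩

theorem HasFactorAt.end_le_of_lt (h : HasFactorAt F q v) {q' : ℕ} {v' : List α}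
    (h' : HasFactorAt F q' v') (hlt : q < q') : q + v.length ≤ q' := by
  obtain ⟨l₁, l₂, rfl, rfl⟩ := h
  obtain ⟨l₁', l₂', he, rfl⟩ := h'
  rcases List.append_eq_append_iff.1 he with ⟨r, rfl, hr⟩ | ⟨r, rfl, -⟩
  · cases r with
    | nil => simp at hlt
    | cons x r =>
      rw [List.cons_append, List.cons.injEq] at hr
      rw [← hr.1, List.flatten_append, List.flatten_cons, List.length_append, List.length_append]
      omega
  · rw [List.flatten_append, List.length_append] at hlt
    omega

end HasFactorAt

section Lyndon

variable [LinearOrder α]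

/-- The lexicographic order is decided by the first mismatch. -/
theorem lt_of_mismatch {s t : List α} {m : ℕ} {c d : α} (h : ∀ i < m, s[i]? = t[i]?)
    (hc : s[m]? = some c) (hd : t[m]? = some d) (hcd : c < d) : s < t := by
  induction m generalizing s t with
  | zero =>
    cases s with
    | nil => simp at hc
    | cons c' s =>
      cases t with
      | nil => simp at hd
      | cons d' t =>
        simp only [List.getElem?_cons_zero, Option.some.injEq] at hc hd
        rw [hc, hd, List.cons_lt_cons_iff]
        exact Or.inl hcd
  | succ m ih =>
    cases s with
    | nil => simp at hc
    | cons c' s =>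
      cases t with
      | nil => simp at hd
      | cons d' t =>
        have h0 := h 0 (Nat.succ_pos m)
        simp only [List.getElem?_cons_zero, Option.some.injEq] at h0
        rw [List.cons_lt_cons_iff]
        exact Or.inr ⟨h0, ih (fun i hi => by simpa using h (i + 1) (by omega))
          (by simpa using hc) (by simpa using hd)⟩

/-- A word that is smaller than another one without being its prefix differs from it in a first
symbol. -/
theorem exists_mismatch {s t : List α} (h : s < t) (hp : ¬ s <+: t) :
    ∃ (m : ℕ) (c d : α), (∀ i < m, s[i]? = t[i]?) ∧ s[m]? = some c ∧ t[m]? = some d ∧ c < d := by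
  induction s generalizing t with
  | nil => simp at hp
  | cons c s ih =>
    cases t with
    | nil => simp at h
    | cons d t =>
      rw [List.cons_lt_cons_iff] at h
      rcases h with h | ⟨rfl, h⟩
      · exact ⟨0, c, d, by simp, by simp, by simp, h⟩
      · obtain ⟨m, c', d', h1, h2, h3, h4⟩ := ih h (by simpa using hp)
        refine ⟨m + 1, c', d', fun i hi => ?_, by simpa using h2, by simpa using h3, h4⟩
        cases i with
        | zero => simp
        | succ i => simpa using h1 i (by omega)

/-- A Lyndon word is smaller than its proper nonempty suffixes. -/
theorem IsLyndon.lt_drop {v : List α} (hv : IsLyndon v) {t : ℕ} (h0 : 0 < t) (ht : t < v.length) :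
    v < v.drop t := by
  by_contra! hle
  have hlen : (v.drop t).length = v.length - t := List.length_drop
  have hlt : v.drop t < v := lt_of_le_of_ne hle fun e => by
    have := congrArg List.length e
    omega
  have hrot := hv.2 t h0 ht
  rw [List.rotate_eq_drop_append_take ht.le] at hrot
  by_cases hp : v.drop t <+: v
  · -- a border `u` of `v = x u = u z` would make the rotation `z u` smaller than `v`
    obtain ⟨z, hz⟩ := hp
    have hrot' := hv.2 (v.drop t).length (by omega) (by omega)
    have hzlen : z.length = (v.take t).length := by
      have := congrArg List.length hz
      rw [List.length_append] at this
      rw [List.length_take]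
      omega
    have e : v.rotate (v.drop t).length = z ++ v.drop t := by
      nth_rewrite 1 [← hz]
      exact List.rotate_append_length_eq _ _
    rw [e] at hrot'
    nth_rewrite 1 [← hz] at hrot
    rw [append_lt_append_left_iff] at hrot
    have := append_lt_append_of_length_eq hzlen hrot (x := v.drop t) (y := v.drop t)
    rw [List.take_append_drop] at this
    exact lt_asymm this hrot'
  · have := append_lt_append_of_lt hlt hp (v.take t) []
    rw [List.append_nil] at this
    exact lt_asymm this hrot

/-- A word `u` that exceeds a Lyndon word `v` by a mismatch also exceeds every concatenation of
words that are at most `v`. -/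
theorem IsLyndon.flatten_lt_append {v : List α} (hv : IsLyndon v) (Y : List α) {l : List (List α)}
    (hl : ∀ x ∈ l, x ≤ v) {u : List α} (hu : v < u) (hp : ¬ v <+: u) : l.flatten < u ++ Y := by
  induction l generalizing u with
  | nil =>
    cases u with
    | nil => simp at hu
    | cons c u => simp
  | cons x l ih =>
    have ih := fun {u} => ih (fun y hy => hl y (List.mem_cons_of_mem _ hy)) (u := u)
    have hxv := hl x (by simp)
    rw [List.flatten_cons]
    by_cases hxu : x <+: u
    · obtain ⟨u', rfl⟩ := hxu
      have hxv' : x <+: v := by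
        by_contra hc
        have := append_lt_append_of_lt (lt_of_le_of_ne hxv fun e => hc (e ▸ List.prefix_refl _)) hc
          u' []
        rw [List.append_nil] at this
        exact lt_asymm this hu
      obtain ⟨z, rfl⟩ := hxv'
      rw [List.append_assoc, append_lt_append_left_iff]
      rw [append_lt_append_left_iff] at hu
      have hp' : ¬ z <+: u' := fun h => hp (by simpa using h)
      rcases Nat.eq_zero_or_pos x.length with hx | hx
      · obtain rfl := List.length_eq_zero_iff.1 hx
        exact ih hu hp'
      have hz : 0 < z.length := by
        rcases Nat.eq_zero_or_pos z.length with hz | hz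
        · obtain rfl := List.length_eq_zero_iff.1 hz
          simp at hp'
        · exact hz
      have hlt : x ++ z < z := by simpa using hv.lt_drop hx (by simp; omega)
      refine ih (hlt.trans hu) ?_
      rintro ⟨r, rfl⟩
      have := append_lt_append_of_lt hlt (fun h => hx.ne' (by simpa using h.length_le)) r []
      rw [List.append_nil] at this
      exact lt_asymm this hu
    · refine append_lt_append_of_lt (hxv.trans_lt hu) hxu _ _

theorem IsLyndon.flatten_lt_append_flatten {v : List α} (hv : IsLyndon v) {l : List (List α)}
    (hl : ∀ x ∈ l, x ≤ v) : l.flatten < v ++ l.flatten := by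
  induction l with
  | nil =>
    cases v with
    | nil => exact absurd rfl hv.1
    | cons c v => simp
  | cons x l ih =>
    have hl' := fun y hy => hl y (List.mem_cons_of_mem _ hy)
    have ih := ih hl'
    rw [List.flatten_cons]
    rcases (hl x (by simp)).eq_or_lt with rfl | hlt
    · rwa [append_lt_append_left_iff]
    · by_cases hp : x <+: v
      · obtain ⟨z, rfl⟩ := hp
        have hz : 0 < z.length := by
          rcases Nat.eq_zero_or_pos z.length with hz | hz
          · obtain rfl := List.length_eq_zero_iff.1 hz
            simp at hlt
          · exact hz
        rcases Nat.eq_zero_or_pos x.length with hx | hx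
        · obtain rfl := List.length_eq_zero_iff.1 hx
          exact ih
        rw [List.append_assoc, append_lt_append_left_iff]
        have hlt : x ++ z < z := by simpa using hv.lt_drop hx (by simp; omega)
        exact hv.flatten_lt_append _ hl' hlt fun h => hx.ne' (by simpa using h.length_le)
      · exact append_lt_append_of_lt hlt hp _ _

/-- In a Lyndon factorization, the suffix that starts with a factor is smaller than all longer
suffixes. -/
theorem HasFactorAt.drop_lt_drop {w v : List α} {F : List (List α)} {q : ℕ}
    (hF : IsLyndonFactorization w F) (h : HasFactorAt F q v) {i : ℕ} (hi : i < q) :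
    w.drop q < w.drop i := by
  obtain ⟨rfl, hL, hP⟩ := hF
  obtain ⟨l₁, l₂, rfl, rfl⟩ := h
  rw [List.length_flatten] at hi
  obtain ⟨c, x, e, rfl, h1, h2⟩ := exists_part_of_lt List.length l₁ hi
  rw [← List.length_flatten] at h1 h2
  have hx : IsLyndon x := hL x (by simp)
  rw [List.pairwise_append, List.pairwise_append] at hP
  obtain ⟨⟨-, hPe, -⟩, -, hle⟩ := hP
  have hle' : ∀ y ∈ v :: l₂, y ≤ x := fun y hy => hle x (by simp) y hy
  have e1 : ((c ++ x :: e) ++ v :: l₂).flatten.drop (c ++ x :: e).flatten.length =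
      (v :: l₂).flatten := by
    generalize c ++ x :: e = l
    rw [List.flatten_append, List.drop_left]
  have e2 : ((c ++ x :: e) ++ v :: l₂).flatten.drop i =
      x.drop (i - c.flatten.length) ++ (e.flatten ++ (v :: l₂).flatten) := by
    rw [List.flatten_append, List.flatten_append, List.append_assoc, List.drop_append,
      List.drop_of_length_le h1, List.nil_append, List.flatten_cons, List.append_assoc,
      List.drop_append_of_le_length (by omega)]
  rw [e1, e2]
  rcases Nat.eq_zero_or_pos (i - c.flatten.length) with h0 | h0
  · rw [h0, List.drop_zero]
    have key : ∀ e : List (List α), ∀ x, IsLyndon x → (∀ y ∈ e, IsLyndon y) →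
        (x :: e).Pairwise (· ≥ ·) → (∀ y ∈ v :: l₂, ∀ z ∈ x :: e, y ≤ z) →
        (v :: l₂).flatten < x ++ (e.flatten ++ (v :: l₂).flatten) := by
      intro e
      induction e with
      | nil => exact fun x hx _ _ hy => hx.flatten_lt_append_flatten fun y h => hy y h x (by simp)
      | cons z e ih =>
        intro x hx he hp hy
        rw [List.pairwise_cons] at hp
        have h1 := ih z (he z (by simp)) (fun y hy => he y (by simp [hy])) hp.2
          fun y h z' hz' => hy y h z' (by simp at hz' ⊢; tauto)
        have h2 : ((z :: e) ++ v :: l₂).flatten < x ++ ((z :: e) ++ v :: l₂).flatten := by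
          refine hx.flatten_lt_append_flatten fun y h => ?_
          rcases List.mem_append.1 h with h | h
          · exact hp.1 y h
          · exact hy y h x (by simp)
        rw [List.flatten_append] at h2
        rw [List.flatten_cons (l := z), List.append_assoc] at h2 ⊢
        exact h1.trans h2
    refine key e x hx (fun y hy => hL y (by simp [hy])) ?_ fun y hy z hz =>
      hle z (List.mem_append_right _ hz) y hy
    exact hPe
  · exact hx.flatten_lt_append _ hle' (hx.lt_drop h0 (by omega)) (not_prefix_drop h0 (by omega))

theorem omegaPrefix_mono {x y : List α} (h : omegaPower x ≤ omegaPower y) (k : ℕ) :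
    omegaPrefix k x ≤ omegaPrefix k y := by
  rcases h.eq_or_lt with h | ⟨m, h1, h2⟩
  · rw [omegaPrefix, omegaPrefix, h]
  · have hlt : ∀ i < m, (omegaPrefix k x)[i]? = (omegaPrefix k y)[i]? := by
      intro i hi
      rcases Nat.lt_or_ge i k with hik | hik
      · rw [getElem?_omegaPrefix hik, getElem?_omegaPrefix hik]
        exact congrArg some (h1 i hi)
      · rw [List.getElem?_eq_none (by rw [length_omegaPrefix]; omega),
          List.getElem?_eq_none (by rw [length_omegaPrefix]; omega)]
    rcases Nat.lt_or_ge m k with hm | hm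
    · exact (lt_of_mismatch hlt (getElem?_omegaPrefix hm x) (getElem?_omegaPrefix hm y) h2).le
    · refine le_of_eq (List.ext_getElem? fun i => ?_)
      rcases Nat.lt_or_ge i m with hi | hi
      · exact hlt i hi
      · rw [List.getElem?_eq_none (by rw [length_omegaPrefix]; omega),
          List.getElem?_eq_none (by rw [length_omegaPrefix]; omega)]

end Lyndon

/-! ### Windows of a word whose rotated Lyndon factors have distinct short prefixes -/

theorem length_flatMap_rotations (l : List (List α)) :
    (l.flatMap rotations).length = l.flatten.length := by
  simp [List.length_flatMap, List.length_flatten, length_rotations]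

theorem HasFactorAt.getElem?_flatMap_rotations {F : List (List α)} {q : ℕ} {v : List α}
    (h : HasFactorAt F q v) {t : ℕ} (ht : t < v.length) :
    (F.flatMap rotations)[q + t]? = some (v.rotate t) := by
  obtain ⟨l₁, l₂, rfl, rfl⟩ := h
  rw [List.flatMap_append, List.flatMap_cons, ← length_flatMap_rotations,
    List.getElem?_append_right (by omega), Nat.add_sub_cancel_left,
    List.getElem?_append_left (by rw [length_rotations]; exact ht)]
  simp [rotations, ht]

section Windows

variable {F : List (List α)} {L : ℕ}

/-- If the rotations of the factors have distinct prefixes, these prefixes determine the positions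
where the rotations start. -/
theorem HasFactorAt.add_eq_add_of_omegaPrefix
    (hnd : ((F.flatMap rotations).map (omegaPrefix L)).Nodup) {q q' t t' : ℕ} {v v' : List α}
    (h : HasFactorAt F q v) (h' : HasFactorAt F q' v') (ht : t < v.length) (ht' : t' < v'.length)
    (he : omegaPrefix L (v.rotate t) = omegaPrefix L (v'.rotate t')) : q + t = q' + t' := by
  have h1 : ((F.flatMap rotations).map (omegaPrefix L))[q + t]? =
      some (omegaPrefix L (v.rotate t)) := by
    rw [List.getElem?_map, h.getElem?_flatMap_rotations ht, Option.map_some]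
  have h2 : ((F.flatMap rotations).map (omegaPrefix L))[q' + t']? =
      some (omegaPrefix L (v'.rotate t')) := by
    rw [List.getElem?_map, h'.getElem?_flatMap_rotations ht', Option.map_some]
  refine (List.getElem?_inj (List.getElem?_eq_some_iff.1 h1).1 hnd).1 ?_
  rw [h1, h2, he]

/-- Windows of length `L` that lie inside factors are distinct. -/
theorem HasFactorAt.add_eq_add_of_window
    (hnd : ((F.flatMap rotations).map (omegaPrefix L)).Nodup) (hL : 0 < L) {q q' t t' : ℕ}
    {v v' : List α} (h : HasFactorAt F q v) (h' : HasFactorAt F q' v') (ht : t + L ≤ v.length)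
    (ht' : t' + L ≤ v'.length)
    (he : ∀ i < L, F.flatten[q + t + i]? = F.flatten[q' + t' + i]?) : q + t = q' + t' := by
  have key : ∀ {q t : ℕ} {v : List α}, HasFactorAt F q v → t + L ≤ v.length → ∀ i < L,
      (omegaPrefix L (v.rotate t))[i]? = some (optionToBot F.flatten[q + t + i]?) := by
    intro q t v h ht i hi
    rw [getElem?_omegaPrefix hi, List.length_rotate, getElem?_rotate_add (by omega),
      Nat.mod_eq_of_lt (by omega), add_assoc, h.getElem? (by omega), add_comm t i]
  refine h.add_eq_add_of_omegaPrefix hnd h' (by omega) (by omega) (List.ext_getElem? fun i => ?_)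
  rcases Nat.lt_or_ge i L with hi | hi
  · rw [key h ht i hi, key h' ht' i hi, he i hi]
  · rw [List.getElem?_eq_none (by rw [length_omegaPrefix]; exact hi),
      List.getElem?_eq_none (by rw [length_omegaPrefix]; exact hi)]

variable [LinearOrder α] {w : List α}

/-- The starts of Lyndon factors are determined by a window that begins at most `2 * L` positions
earlier, provided that some factor starts in between.  The reason is that inside a Lyndon word every
suffix exceeds the word itself, whereas a suffix of `w` that starts with a factor is smaller than
all longer suffixes. -/
theorem HasFactorAt.of_window (hF : IsLyndonFactorization w F)
    (hnd : ((F.flatMap rotations).map (omegaPrefix L)).Nodup) (hL : 0 < L) {p p' o t' : ℕ}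
    {v v' : List α} (hp' : p' + 3 * L ≤ w.length)
    (hX : ∀ i < 3 * L, w[p + i]? = w[p' + i]?) (ho : o ≤ 2 * L) (h : HasFactorAt F (p + o) v)
    (h' : HasFactorAt F (p' + t') v') (ht' : t' ≤ o) : ∃ u, HasFactorAt F (p' + o) u := by
  have hw : F.flatten = w := hF.1
  obtain ⟨q, u, hu, hq, hq'⟩ := exists_hasFactorAt (F := F) (p := p' + o) (by rw [hw]; omega)
  rcases hq.eq_or_lt with rfl | hq
  · exact ⟨u, hu⟩
  exfalso
  have hle : p' + t' ≤ q := by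
    by_contra! hlt
    have := hu.end_le_of_lt h' hlt
    omega
  obtain ⟨t, rfl⟩ := Nat.exists_eq_add_of_le (show p' ≤ q by omega)
  have hul : IsLyndon u := hF.2.1 u hu.mem
  obtain ⟨m, c, d, h1, h2, h3, h4⟩ := exists_mismatch
    (hul.lt_drop (t := o - t) (by omega) (by omega)) (not_prefix_drop (by omega) (by omega))
  have hm : m < u.length - (o - t) := by
    have := (List.getElem?_eq_some_iff.1 h3).1
    rwa [List.length_drop] at this
  have h1' : ∀ i < m, w[p' + t + i]? = w[p' + o + i]? := by
    intro i hi
    have := h1 i hi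
    rw [List.getElem?_drop] at this
    rw [← hw, hu.getElem? (by omega), this, ← hu.getElem? (by omega)]
    congr 1
    omega
  rcases Nat.lt_or_ge m (3 * L - o) with hmL | hmL
  · -- the mismatch is visible in the window, so it also occurs in the first occurrence
    refine lt_asymm (h.drop_lt_drop hF (i := p + t) (by omega)) ?_
    refine lt_of_mismatch (m := m) (c := c) (d := d) (fun i hi => ?_) ?_ ?_ h4
    · rw [List.getElem?_drop, List.getElem?_drop, add_assoc, add_assoc, hX _ (by omega),
        hX _ (by omega), ← add_assoc, ← add_assoc]
      exact h1' i hi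
    · rw [List.getElem?_drop, add_assoc, hX _ (by omega), ← add_assoc, ← hw,
        hu.getElem? (by omega), h2]
    · rw [List.getElem?_drop, add_assoc, hX _ (by omega), ← h3, List.getElem?_drop,
        ← hu.getElem? (by omega), hw]
      congr 1
      omega
  · -- otherwise two windows of length `L` inside `u` agree
    have := hu.add_eq_add_of_window hnd hL hu (t := 0) (t' := o - t) (by omega) (by omega)
      fun i hi => by
        rw [hw, add_zero, h1' i (by omega)]
        congr 1
        omega
    omega

/-- If a factor starts at the same offset in two equal windows, the windows coincide: the factor is
either determined by the window or long enough to have a distinctive prefix. -/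
theorem eq_of_window_of_start (hF : IsLyndonFactorization w F)
    (hnd : ((F.flatMap rotations).map (omegaPrefix L)).Nodup) (hL : 0 < L) {p p' o : ℕ}
    {v v' : List α} (hp : p + 3 * L ≤ w.length) (hp' : p' + 3 * L ≤ w.length)
    (hX : ∀ i < 3 * L, w[p + i]? = w[p' + i]?) (ho : o ≤ L) (h : HasFactorAt F (p + o) v)
    (h' : HasFactorAt F (p' + o) v') (hvv' : v.length ≤ v'.length) : p = p' := by
  have hw : F.flatten = w := hF.1
  have hv : 0 < v.length := List.length_pos_iff.2 (hF.2.1 v h.mem).1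
  rcases Nat.lt_or_ge v.length L with hvL | hvL
  · -- the factor `v` lies in the window, and both factors end at the same place
    obtain ⟨u, hu⟩ := h.next (by rw [hw]; omega)
    rw [add_assoc] at hu
    obtain ⟨u', hu'⟩ := HasFactorAt.of_window hF hnd hL hp' hX (by omega) hu h' (by omega)
    have h1 := h'.end_le_of_lt hu' (by omega)
    have hl : v.length = v'.length := by omega
    obtain rfl : v = v' := by
      refine List.ext_getElem? fun i => ?_
      rcases Nat.lt_or_ge i v.length with hi | hi
      · rw [← h.getElem? hi, ← h'.getElem? (by omega), hw, add_assoc, add_assoc]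
        exact hX _ (by omega)
      · rw [List.getElem?_eq_none hi, List.getElem?_eq_none (by omega)]
    have := h.add_eq_add_of_omegaPrefix hnd h' hv hv rfl
    omega
  · have := h.add_eq_add_of_window hnd hL h' (t := 0) (t' := 0) (by omega) (by omega) fun i hi => by
      rw [hw, add_zero, add_zero, add_assoc, add_assoc]
      exact hX _ (by omega)
    omega

/-- Windows of length `3 * L` are distinct if a factor starts close to their beginnings. -/
theorem eq_of_window (hF : IsLyndonFactorization w F)
    (hnd : ((F.flatMap rotations).map (omegaPrefix L)).Nodup) (hL : 0 < L) {p p' o o' : ℕ}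
    {v v' : List α} (hp : p + 3 * L ≤ w.length) (hp' : p' + 3 * L ≤ w.length)
    (hX : ∀ i < 3 * L, w[p + i]? = w[p' + i]?) (ho : o ≤ L) (ho' : o' ≤ L)
    (h : HasFactorAt F (p + o) v) (h' : HasFactorAt F (p' + o') v') : p = p' := by
  have key : ∀ {p p' o : ℕ} {v v' : List α}, p + 3 * L ≤ w.length → p' + 3 * L ≤ w.length →
      (∀ i < 3 * L, w[p + i]? = w[p' + i]?) → o ≤ L → HasFactorAt F (p + o) v →
      HasFactorAt F (p' + o) v' → p = p' := by
    intro p p' o v v' hp hp' hX ho h h'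
    rcases le_total v.length v'.length with hl | hl
    · exact eq_of_window_of_start hF hnd hL hp hp' hX ho h h' hl
    · exact (eq_of_window_of_start hF hnd hL hp' hp (fun i hi => (hX i hi).symm) ho h' h hl).symm
  rcases le_total o o' with hoo | hoo
  · obtain ⟨u, hu⟩ := HasFactorAt.of_window hF hnd hL hp (fun i hi => (hX i hi).symm) (by omega)
      h' h hoo
    exact key hp hp' hX ho' hu h'
  · obtain ⟨u, hu⟩ := HasFactorAt.of_window hF hnd hL hp' hX (by omega) h h' hoo
    exact key hp hp' hX ho h hu

/-- There are at least half as many substrings of length `3 * L` as windows of this length: either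
many of them begin with a window of length `L` inside a factor, or a factor starts close to the
beginnings of many of them. -/
theorem le_two_mul_substringCount (hF : IsLyndonFactorization w F)
    (hnd : ((F.flatMap rotations).map (omegaPrefix L)).Nodup) (hL : 0 < L)
    (hLw : 3 * L ≤ w.length) : w.length - 3 * L + 1 ≤ 2 * substringCount w (3 * L) := by
  classical
  have hw : F.flatten = w := hF.1
  let P := Finset.range (w.length - 3 * L + 1)
  have hP : ∀ p ∈ P, p + 3 * L ≤ w.length := by
    intro p hp
    have := Finset.mem_range.1 hp
    omega
  let A : ℕ → Prop := fun p => ∃ q v t, HasFactorAt F q v ∧ p = q + t ∧ t + L ≤ v.length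
  have h1 : (P.filter A).card ≤ substringCount w (3 * L) := by
    refine card_le_substringCount _ (fun p hp => hP p (Finset.mem_filter.1 hp).1) ?_
    intro p hp p' hp' he
    obtain ⟨q, v, t, h, rfl, ht⟩ := (Finset.mem_filter.1 hp).2
    obtain ⟨q', v', t', h', rfl, ht'⟩ := (Finset.mem_filter.1 hp').2
    refine h.add_eq_add_of_window hnd hL h' ht ht' fun i hi => ?_
    rw [hw]
    exact factor_eq_factor_iff.1 he i (by omega)
  have h2 : (P.filter fun p => ¬ A p).card ≤ substringCount w (3 * L) := by
    refine card_le_substringCount _ (fun p hp => hP p (Finset.mem_filter.1 hp).1) ?_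
    have hstart : ∀ p, p + 3 * L ≤ w.length → ¬ A p → ∃ o v, o ≤ L ∧ HasFactorAt F (p + o) v := by
      intro p hp hA
      obtain ⟨q, v, h, hq, hq'⟩ := exists_hasFactorAt (F := F) (p := p) (by rw [hw]; omega)
      have hlt : q + v.length < p + L := by
        by_contra! hc
        exact hA ⟨q, v, p - q, h, by omega, by omega⟩
      obtain ⟨v', h'⟩ := h.next (by rw [hw]; omega)
      exact ⟨q + v.length - p, v', by omega, by rwa [Nat.add_sub_cancel' hq'.le]⟩
    intro p hp p' hp' he
    have hp := Finset.mem_filter.1 hp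
    have hp' := Finset.mem_filter.1 hp'
    obtain ⟨o, v, ho, h⟩ := hstart p (hP p hp.1) hp.2
    obtain ⟨o', v', ho', h'⟩ := hstart p' (hP p' hp'.1) hp'.2
    exact eq_of_window hF hnd hL (hP p hp.1) (hP p' hp'.1) (factor_eq_factor_iff.1 he) ho ho' h h'
  have h3 := Finset.card_filter_add_card_filter_not (s := P) A
  rw [Finset.card_range] at h3
  omega

end Windows

/-! ### Backward search in the bijective Burrows-Wheeler transform -/

theorem filter_eq_take_countP {β : Type*} {p : β → Bool} {l : List β}
    (h : l.Pairwise fun u v => p v → p u) : l.filter p = l.take (l.countP p) := by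
  induction l with
  | nil => rfl
  | cons u l ih =>
    rw [List.pairwise_cons] at h
    by_cases hu : p u
    · rw [List.filter_cons_of_pos hu, List.countP_cons_of_pos hu, List.take_succ_cons, ih h.2]
    · have h0 : ∀ v ∈ l, ¬ p v := fun v hv hpv => hu (h.1 v hv hpv)
      rw [List.filter_cons_of_neg hu, List.countP_cons_of_neg hu, List.countP_eq_zero.2 h0,
        List.take_zero, List.filter_eq_nil_iff]
      exact h0

theorem countP_eq_add_of_disjoint {β : Type*} {p q r : β → Bool} {l : List β}
    (hr : ∀ y, r y ↔ p y ∨ q y) (hd : ∀ y, p y → ¬ q y) :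
    l.countP r = l.countP p + l.countP q := by
  induction l with
  | nil => rfl
  | cons y l ih =>
    have h1 := hr y
    have h2 := hd y
    rw [List.countP_cons, List.countP_cons, List.countP_cons, ih]
    split_ifs <;> first | omega | simp_all

theorem length_pos_of_mem_flatMap_rotations {F : List (List α)} {y : List α}
    (hy : y ∈ F.flatMap rotations) : 0 < y.length := by
  obtain ⟨v, -, hv⟩ := List.mem_flatMap.1 hy
  have h1 : 0 < (rotations v).length := List.length_pos_of_mem hv
  rwa [length_rotations, ← length_of_mem_rotations hv] at h1

/-- Prefixes of length `k + 1`, split into the first symbol and the remaining prefix of length `k`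
of the next rotation. -/
theorem map_omegaPrefix_succ_perm (F : List (List α)) (k : ℕ) :
    ((F.flatMap rotations).map (omegaPrefix (k + 1))).Perm
      ((F.flatMap rotations).map fun y => optionToBot y.getLast? :: omegaPrefix k y) := by
  have h1 : (F.flatMap rotations).map (omegaPrefix (k + 1)) =
      ((F.flatMap rotations).map fun y => y.rotate 1).map
        fun y => optionToBot y.getLast? :: omegaPrefix k y := by
    rw [List.map_map]
    exact List.map_congr_left fun y hy =>
      omegaPrefix_succ (length_pos_of_mem_flatMap_rotations hy) k
  rw [h1]
  refine List.Perm.map _ ?_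
  rw [List.map_flatMap]
  exact List.Perm.flatMap_left _ fun v _ => map_rotate_one_rotations_perm v

section Search

variable [LinearOrder α]

theorem isLyndonFactorization_lyndonFactors (w : List α) :
    IsLyndonFactorization w (lyndonFactors w) :=
  (exists_isLyndonFactorization w).choose_spec

/-- The rotations of the Lyndon factors of `w`. -/
noncomputable def factorRotations (w : List α) : List (List α) :=
  (lyndonFactors w).flatMap rotations

theorem length_factorRotations (w : List α) : (factorRotations w).length = w.length := by
  rw [factorRotations, length_flatMap_rotations, (isLyndonFactorization_lyndonFactors w).1]

theorem map_some_bbwt (w : List α) : (bbwt w).map some = ((factorRotations w).insertionSort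
    fun x y => omegaPower x ≤ omegaPower y).map List.getLast? := by
  refine map_some_filterMap fun y hy => ?_
  rw [List.mem_insertionSort] at hy
  have := length_pos_of_mem_flatMap_rotations hy
  rw [List.length_pos_iff] at this
  simpa using this

theorem length_bbwt (w : List α) : (bbwt w).length = w.length := by
  have := congrArg List.length (map_some_bbwt w)
  rwa [List.length_map, List.length_map, List.length_insertionSort, length_factorRotations] at this

theorem exists_getLast?_of_mem_factorRotations {w y : List α} (hy : y ∈ factorRotations w) :
    ∃ c ∈ bbwt w, y.getLast? = some c := by
  have : y.getLast? ∈ (bbwt w).map some := by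
    rw [map_some_bbwt]
    exact List.mem_map_of_mem ((List.mem_insertionSort _).2 hy)
  obtain ⟨c, hc, h⟩ := List.mem_map.1 this
  exact ⟨c, hc, h.symm⟩

/-- The rotations with a downward closed property form a prefix of the sorted list of rotations. -/
theorem countP_getLast?_and {w : List α} {Q : List α → Bool}
    (hQ : ∀ x y, omegaPower x ≤ omegaPower y → Q y → Q x) (c : α) :
    (factorRotations w).countP (fun y => decide (y.getLast? = some c) && Q y) =
      ((bbwt w).take ((factorRotations w).countP Q)).count c := by
  set R := (factorRotations w).insertionSort fun x y => omegaPower x ≤ omegaPower y with hR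
  have hperm : R.Perm (factorRotations w) := List.perm_insertionSort _ _
  have : Std.Total fun x y : List α => omegaPower x ≤ omegaPower y :=
    ⟨fun x y => le_total _ _⟩
  have : IsTrans (List α) fun x y => omegaPower x ≤ omegaPower y :=
    ⟨fun x y z h1 h2 => le_trans h1 h2⟩
  have hsort : R.Pairwise fun x y => omegaPower x ≤ omegaPower y := List.pairwise_insertionSort _ _
  rw [← hperm.countP_eq, ← hperm.countP_eq, ← List.countP_filter,
    filter_eq_take_countP (hsort.imp fun h => hQ _ _ h),
    ← List.count_map_of_injective _ some (Option.some_injective α), List.map_take, map_some_bbwt,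
    ← hR, ← List.map_take, List.count, List.countP_map]
  refine List.countP_congr fun y _ => ?_
  simp

theorem cons_le_cons_iff_lt_or {β : Type*} [LinearOrder β] {c d : β} {x y : List β} :
    c :: x ≤ d :: y ↔ c < d ∨ c = d ∧ x ≤ y := by
  rw [← not_lt, List.cons_lt_cons_iff, ← not_lt (a := y)]
  constructor
  · intro h
    rcases lt_trichotomy c d with h1 | h1 | h1
    · exact Or.inl h1
    · exact Or.inr ⟨h1, fun h2 => h (Or.inr ⟨h1.symm, h2⟩)⟩
    · exact absurd (Or.inl h1) h
  · rintro (h | ⟨rfl, h⟩) (h' | ⟨h1, h'⟩)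
    · exact lt_asymm h h'
    · exact h.ne' h1
    · exact lt_irrefl _ h'
    · exact h h'

/-- The number of rotations that end with a symbol smaller than `c`. -/
noncomputable def smallerCount (w : List α) (c : α) : ℕ :=
  (factorRotations w).countP fun y => decide (optionToBot y.getLast? < (c : WithBot α))

/-- One step of backward search, for a lower or upper bound of the interval of a word. -/
theorem countP_omegaPrefix_succ {w : List α} {k : ℕ} {c : α} {P P' : List (WithBot α) → Bool}
    (hP' : ∀ u y, P' (u :: y) ↔ u < (c : WithBot α) ∨ u = (c : WithBot α) ∧ P y)
    (hP : ∀ x y, x ≤ y → P y → P x) :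
    (factorRotations w).countP (fun y => P' (omegaPrefix (k + 1) y)) = smallerCount w c +
      ((bbwt w).take ((factorRotations w).countP fun y => P (omegaPrefix k y))).count c := by
  have h1 := (map_omegaPrefix_succ_perm (lyndonFactors w) k).countP_eq P'
  rw [List.countP_map, List.countP_map] at h1
  rw [← countP_getLast?_and fun x y h => hP _ _ (omegaPrefix_mono h k)]
  refine h1.trans (countP_eq_add_of_disjoint (fun y => ?_) fun y hy hy' => ?_)
  · rw [Function.comp_apply, hP', Bool.and_eq_true, decide_eq_true_iff, decide_eq_true_iff]
    exact Iff.rfl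
  · rw [Bool.and_eq_true, decide_eq_true_iff] at hy'
    rw [decide_eq_true_iff, hy'.1] at hy
    exact lt_irrefl _ hy

/-- The number of rotations `y` such that the prefix of `y^∞` is smaller than `x`. -/
noncomputable def lowerBound (w x : List α) : ℕ :=
  (factorRotations w).countP fun y => decide (omegaPrefix x.length y < x.map WithBot.some)

/-- The number of rotations `y` such that the prefix of `y^∞` is at most `x`. -/
noncomputable def upperBound (w x : List α) : ℕ :=
  (factorRotations w).countP fun y => decide (omegaPrefix x.length y ≤ x.map WithBot.some)

theorem lowerBound_cons (w : List α) (c : α) (x : List α) :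
    lowerBound w (c :: x) = smallerCount w c + ((bbwt w).take (lowerBound w x)).count c := by
  refine countP_omegaPrefix_succ
    (P' := fun y => decide (y < (c :: x).map WithBot.some))
    (P := fun y => decide (y < x.map WithBot.some)) (fun u y => ?_) fun u y h h' => ?_
  · rw [decide_eq_true_iff, decide_eq_true_iff, List.map_cons, List.cons_lt_cons_iff]
  · rw [decide_eq_true_iff] at h' ⊢
    exact h.trans_lt h'

theorem upperBound_cons (w : List α) (c : α) (x : List α) :
    upperBound w (c :: x) = smallerCount w c + ((bbwt w).take (upperBound w x)).count c := by
  refine countP_omegaPrefix_succ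
    (P' := fun y => decide (y ≤ (c :: x).map WithBot.some))
    (P := fun y => decide (y ≤ x.map WithBot.some)) (fun u y => ?_) fun u y h h' => ?_
  · rw [decide_eq_true_iff, decide_eq_true_iff, List.map_cons, cons_le_cons_iff_lt_or]
  · rw [decide_eq_true_iff] at h' ⊢
    exact h.trans h'

theorem upperBound_eq (w x : List α) : upperBound w x = lowerBound w x +
    (factorRotations w).countP
      fun y => decide (omegaPrefix x.length y = x.map WithBot.some) := by
  refine countP_eq_add_of_disjoint (fun y => ?_) fun y => ?_
  · simp only [decide_eq_true_iff]
    exact le_iff_lt_or_eq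
  · simp only [decide_eq_true_iff]
    exact fun h => h.ne

theorem upperBound_le (w x : List α) : upperBound w x ≤ w.length := by
  rw [← length_factorRotations w]
  exact List.countP_le_length

theorem smallerCount_eq_zero {w : List α} {a : α} (h : ∀ c ∈ bbwt w, a ≤ c) :
    smallerCount w a = 0 := by
  refine List.countP_eq_zero.2 fun y hy hlt => ?_
  obtain ⟨c, hc, he⟩ := exists_getLast?_of_mem_factorRotations hy
  rw [decide_eq_true_iff, he] at hlt
  exact absurd (WithBot.coe_le_coe.2 (h c hc)) (not_le.2 hlt)

/-- Prefixes of a given length are distinct if the intervals of all words of this length contain at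
most one rotation. -/
theorem nodup_map_omegaPrefix {w : List α} {k : ℕ}
    (h : ∀ x : List α, x.length = k → upperBound w x ≤ lowerBound w x + 1) :
    ((factorRotations w).map (omegaPrefix k)).Nodup := by
  rw [List.nodup_iff_count_le_one]
  intro x
  by_cases hx : x ∈ (factorRotations w).map (omegaPrefix k)
  swap
  · rw [List.count_eq_zero.2 hx]
    exact Nat.zero_le 1
  obtain ⟨y, hy, rfl⟩ := List.mem_map.1 hx
  have hy0 := length_pos_of_mem_flatMap_rotations hy
  obtain ⟨x, hxl, hxe⟩ : ∃ x : List α, x.length = k ∧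
      omegaPrefix k y = x.map WithBot.some := by
    refine ⟨(List.range k).map fun i => y[i % y.length]'(Nat.mod_lt _ hy0), by simp, ?_⟩
    rw [List.map_map]
    refine List.map_congr_left fun i _ => ?_
    exact List.getElem?_eq_getElem (Nat.mod_lt _ hy0)
  have h1 := h x hxl
  rw [upperBound_eq, hxl] at h1
  rw [hxe, List.count, List.countP_map]
  refine le_trans (le_of_eq (List.countP_congr fun z _ => ?_)) (Nat.le_of_add_le_add_left h1)
  simp

end Search

/-! ### Intervals of backward search for Fibonacci-like words -/

theorem count_take_add [DecidableEq α] (s : List α) (c : α) (m j : ℕ) :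
    (s.take (m + j)).count c = (s.take m).count c + (factor s m j).count c := by
  rw [List.take_add, List.count_append, factor]

theorem count_take_mono [DecidableEq α] (s : List α) (c : α) {m m' : ℕ} (h : m ≤ m') :
    (s.take m).count c ≤ (s.take m').count c := by
  obtain ⟨j, rfl⟩ := Nat.exists_eq_add_of_le h
  rw [count_take_add]
  exact Nat.le_add_right _ _

theorem count_take_add_le [DecidableEq α] (s : List α) (c : α) (m j : ℕ) :
    (s.take (m + j)).count c ≤ (s.take m).count c + j := by
  rw [count_take_add]
  refine Nat.add_le_add_left (List.count_le_length.trans ?_) _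
  simp [factor]

theorem count_take_add_lt [DecidableEq α] {s : List α} {c : α} {j : ℕ}
    (h : ¬ List.replicate j c <:+: s) (m : ℕ) :
    (s.take (m + j)).count c < (s.take m).count c + j := by
  rw [count_take_add]
  refine Nat.add_lt_add_left ?_ _
  by_contra! hle
  have h1 : (factor s m j).length ≤ j := by simp [factor]
  have h2 : (factor s m j).count c ≤ (factor s m j).length := List.count_le_length
  refine h ?_
  have h3 : factor s m j = List.replicate j c := by
    rw [List.eq_replicate_iff]
    exact ⟨by omega, fun d hd => (List.count_eq_length.1 (by omega) d hd).symm⟩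
  rw [← h3]
  exact ((List.take_prefix _ _).isInfix).trans (List.drop_suffix _ _).isInfix

/-- A counting function that skips a step in every three consecutive ones. -/
theorem three_mul_le_of_add_three {f : ℕ → ℕ} (h1 : ∀ m, f (m + 1) ≤ f m + 1)
    (h3 : ∀ m, f (m + 3) ≤ f m + 2) (m d : ℕ) : 3 * f (m + d) ≤ 3 * f m + 2 * d + 2 := by
  induction d using Nat.strong_induction_on with
  | _ d ih =>
    rcases Nat.lt_or_ge d 3 with hd | hd
    · have e1 := h1 m
      have e2 := h1 (m + 1)
      interval_cases d
      · simp
      · omega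
      · rw [show m + 2 = m + 1 + 1 from rfl]
        omega
    · obtain ⟨d, rfl⟩ := Nat.exists_eq_add_of_le' hd
      have e1 := ih d (by omega)
      have e2 := h3 (m + d)
      rw [← add_assoc]
      omega

/-- A counting function that skips one of any two consecutive steps. -/
theorem two_mul_le_of_add_two {f : ℕ → ℕ} (h1 : ∀ m, f (m + 1) ≤ f m + 1)
    (h2 : ∀ m, f (m + 2) ≤ f m + 1) (m d : ℕ) : 2 * f (m + d) ≤ 2 * f m + d + 1 := by
  induction d using Nat.strong_induction_on with
  | _ d ih =>
    rcases Nat.lt_or_ge d 2 with hd | hd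
    · have e1 := h1 m
      interval_cases d
      · simp
      · omega
    · obtain ⟨d, rfl⟩ := Nat.exists_eq_add_of_le' hd
      have e1 := ih d (by omega)
      have e2 := h2 (m + d)
      rw [← add_assoc]
      omega

/-- The properties of Fibonacci words that make the inverse transform incompressible: a binary word
that begins with `ab` and does not contain `aaa` or `bb`. -/
structure IsFibLike (a b : α) (s : List α) : Prop where
  mem : ∀ c ∈ s, c = a ∨ c = b
  not_bb : ¬ [b, b] <:+: s
  not_aaa : ¬ [a, a, a] <:+: s
  ab_prefix : [a, b] <+: s

theorem isFibLike_fibWord {a b : α} (hab : a ≠ b) (k : ℕ) : IsFibLike a b (fibWord a b (k + 2)) :=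
  ⟨fun _ h => mem_fibWord h, not_bb_infix_fibWord hab _, not_aaa_infix_fibWord hab _,
    fibWord_prefix_fibWord a b (i := 1) (k := k + 1) (by omega)⟩

namespace IsFibLike

variable [DecidableEq α] {a b : α} {s : List α}

theorem three_mul_count_le (h : IsFibLike a b s) (m d : ℕ) :
    3 * (s.take (m + d)).count a ≤ 3 * (s.take m).count a + 2 * d + 2 :=
  three_mul_le_of_add_three (f := fun m => (s.take m).count a)
    (fun m => count_take_add_le s a m 1)
    (fun m => Nat.le_of_lt_succ (count_take_add_lt (j := 3) h.not_aaa m)) m d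

theorem two_mul_count_le (h : IsFibLike a b s) {c : α} (hc : c ≠ a) (m d : ℕ) :
    2 * (s.take (m + d)).count c ≤ 2 * (s.take m).count c + d + 1 := by
  by_cases hcb : c = b
  · subst hcb
    exact two_mul_le_of_add_two (f := fun m => (s.take m).count c)
      (fun m => count_take_add_le s c m 1)
      (fun m => Nat.le_of_lt_succ (count_take_add_lt (j := 2) h.not_bb m)) m d
  · have : ∀ m, (s.take m).count c = 0 := fun m => List.count_eq_zero.2 fun hm =>
      (h.mem c (List.mem_of_mem_take hm)).elim hc hcb
    rw [this, this]
    omega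

theorem count_take_two (h : IsFibLike a b s) (hab : a ≠ b) : (s.take 2).count a = 1 := by
  obtain ⟨t, rfl⟩ := h.ab_prefix
  simp [hab.symm]

/-- Backward search in a Fibonacci-like word: the length of an interval shrinks geometrically until
it is at most two.  An interval of length two can only keep its length along occurrences of `aa`,
and then its lower end shrinks geometrically, because the word begins with `ab`. -/
theorem interval_le_one (h : IsFibLike a b s) (hab : a ≠ b) {n : ℕ} {lo hi : List α → ℕ}
    {K : α → ℕ} (hK : K a = 0) (hlo : ∀ c x, lo (c :: x) = K c + (s.take (lo x)).count c)
    (hhi : ∀ c x, hi (c :: x) = K c + (s.take (hi x)).count c) (hle : ∀ x, lo x ≤ hi x)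
    (hn : ∀ x, hi x ≤ n) {l : ℕ} (hl : 4 ^ l * n < 5 ^ l) {x : List α}
    (hx : x.length = 2 * l + 1) : hi x ≤ lo x + 1 := by
  have hmono : ∀ c x d, hi x ≤ lo x + d → hi (c :: x) ≤ lo (c :: x) + d := by
    intro c x d hd
    rw [hlo, hhi]
    have := (count_take_mono s c hd).trans (count_take_add_le s c (lo x) d)
    omega
  have hshrink : ∀ c x, hi x ≤ lo x + 2 ∨
      5 * (hi (c :: x) - lo (c :: x)) ≤ 4 * (hi x - lo x) := by
    intro c x
    obtain ⟨d, hd⟩ := Nat.exists_eq_add_of_le (hle x)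
    rw [hlo, hhi, hd]
    by_cases hc : c = a
    · subst hc
      have := h.three_mul_count_le (lo x) d
      rcases Nat.lt_or_ge d 5 with h5 | h5
      · interval_cases d <;> omega
      · omega
    · have := h.two_mul_count_le hc (lo x) d
      omega
  have hlower : ∀ c x, hi x ≤ lo x + 2 → hi (c :: x) ≤ lo (c :: x) + 1 ∨
      (2 ≤ lo x ∧ 5 * lo (c :: x) ≤ 4 * lo x) := by
    intro c x hd
    have hd' := count_take_mono s c hd
    rw [hlo, hhi]
    by_cases hc : c = a
    · subst hc
      have h2 := h.count_take_two hab
      have h3 := h.three_mul_count_le 2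
      rcases Nat.lt_or_ge (lo x) 2 with h4 | h4
      · left
        have h5 := count_take_mono s c (Nat.le_add_left 2 (lo x))
        rcases Nat.lt_or_ge (lo x) 1 with h6 | h6
        · rw [show lo x + 2 = 2 by omega] at hd'
          omega
        · rw [show lo x + 2 = 2 + 1 by omega] at hd'
          rw [show lo x = 1 by omega]
          have h7 := count_take_add_le s c 2 1
          have h8 : (s.take 1).count c = 1 := by
            obtain ⟨t, rfl⟩ := h.ab_prefix
            simp
          omega
      · right
        obtain ⟨d, hd⟩ := Nat.exists_eq_add_of_le h4
        have := h3 d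
        rw [← hd] at this
        omega
    · left
      have := h.two_mul_count_le hc (lo x) 2
      omega
  have hfirst : ∀ x : List α, hi x ≤ lo x + 2 ∨
      5 ^ x.length * (hi x - lo x) ≤ 4 ^ x.length * n := by
    intro x
    induction x with
    | nil =>
      right
      have := hn []
      simp only [List.length_nil, pow_zero, one_mul]
      omega
    | cons c x ih =>
      rcases ih with ih | ih
      · exact Or.inl (hmono c x 2 ih)
      · refine (hshrink c x).imp (hmono c x 2) fun h5 => ?_
        rw [List.length_cons, pow_succ, pow_succ, mul_assoc]
        calc 5 ^ x.length * (5 * (hi (c :: x) - lo (c :: x)))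
            ≤ 5 ^ x.length * (4 * (hi x - lo x)) := Nat.mul_le_mul_left _ h5
          _ = 4 * (5 ^ x.length * (hi x - lo x)) := by ring
          _ ≤ 4 * (4 ^ x.length * n) := Nat.mul_le_mul_left _ ih
          _ = 4 ^ x.length * 4 * n := by ring
  have hsmall : ∀ m : ℕ, 5 ^ l * m ≤ 4 ^ l * n → m = 0 := by
    intro m hm
    by_contra h0
    have := Nat.le_mul_of_pos_right (5 ^ l) (Nat.pos_of_ne_zero h0)
    omega
  have hsecond : ∀ y x : List α, x.length = l → hi (y ++ x) ≤ lo (y ++ x) + 1 ∨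
      hi (y ++ x) ≤ lo (y ++ x) + 2 ∧ 5 ^ y.length * lo (y ++ x) ≤ 4 ^ y.length * n := by
    intro y x hx
    induction y with
    | nil =>
      right
      refine ⟨?_, ?_⟩
      · rcases hfirst x with h1 | h1
        · exact h1
        · rw [hx] at h1
          have := hsmall _ h1
          rw [List.nil_append]
          omega
      · have h1 := hle x
        have h2 := hn x
        simp only [List.length_nil, pow_zero, one_mul, List.nil_append]
        omega
    | cons c y ih =>
      rcases ih with ih | ⟨ih1, ih2⟩
      · exact Or.inl (hmono c _ 1 ih)
      · refine (hlower c _ ih1).imp id fun h5 => ⟨hmono c _ 2 ih1, ?_⟩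
        rw [List.length_cons, pow_succ, pow_succ, mul_assoc]
        calc 5 ^ y.length * (5 * lo (c :: (y ++ x)))
            ≤ 5 ^ y.length * (4 * lo (y ++ x)) := Nat.mul_le_mul_left _ h5.2
          _ = 4 * (5 ^ y.length * lo (y ++ x)) := by ring
          _ ≤ 4 * (4 ^ y.length * n) := Nat.mul_le_mul_left _ ih2
          _ = 4 ^ y.length * 4 * n := by ring
  cases x with
  | nil => simp at hx
  | cons c x =>
    rw [List.length_cons] at hx
    have h1 := hsecond (x.take l) (x.drop l) (by rw [List.length_drop]; omega)
    rw [List.take_append_drop, List.length_take, min_eq_left (by omega)] at h1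
    rcases h1 with h1 | ⟨h1, h2⟩
    · exact hmono c x 1 h1
    · have h3 := hsmall _ h2
      rcases hlower c x h1 with h4 | h4
      · exact h4
      · omega

end IsFibLike

theorem nodup_map_omegaPrefix_of_isFibLike [LinearOrder α] {w : List α} {a b : α} (hab : a < b)
    (h : IsFibLike a b (bbwt w)) {l : ℕ} (hl : 4 ^ l * w.length < 5 ^ l) :
    ((factorRotations w).map (omegaPrefix (2 * l + 1))).Nodup := by
  refine nodup_map_omegaPrefix fun x hx => ?_
  refine h.interval_le_one hab.ne (K := smallerCount w) (smallerCount_eq_zero fun c hc => ?_)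
    (lowerBound_cons w) (upperBound_cons w) (fun x => ?_) (upperBound_le w) hl hx
  · rcases h.mem c hc with rfl | rfl
    exacts [le_rfl, hab.le]
  · rw [upperBound_eq]
    exact Nat.le_add_right _ _

/-! ### Asymptotic bounds -/

theorem one_le_delta {w : List α} (hw : 1 ≤ w.length) : 1 ≤ delta w := by
  have h1 : 1 ≤ substringCount w 1 :=
    card_le_substringCount {0} (fun p hp => by rw [Finset.mem_singleton.1 hp]; omega) (by simp)
  have h2 := substringCount_le_mul_delta (w := w) le_rfl hw
  rw [Nat.cast_one, one_mul] at h2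
  exact (Nat.one_le_cast.2 h1).trans h2

theorem log_two_le_log {n : ℕ} (hn : 2 ≤ n) : (0.69 : ℝ) ≤ Real.log n := by
  have h1 := Real.log_two_gt_d9
  have h2 : Real.log 2 ≤ Real.log n := Real.log_le_log (by norm_num) (by exact_mod_cast hn)
  linarith

/-- An exponent `l` of logarithmic size with `(5 / 4) ^ l > n`, the number of steps after which a
quantity that starts at `n` and shrinks by the factor `4 / 5` vanishes. -/
theorem exists_pow_mul_lt_pow {n : ℕ} (hn : 2 ≤ n) :
    ∃ l : ℕ, 4 ^ l * n < 5 ^ l ∧ (l : ℝ) ≤ 5 * Real.log n + 1 := by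
  have hlog := log_two_le_log hn
  refine ⟨⌊5 * Real.log n⌋₊ + 1, ?_, ?_⟩
  · set l := ⌊5 * Real.log n⌋₊ + 1 with hl
    have h1 : 5 * Real.log n < l := by
      rw [hl, Nat.cast_add_one]
      exact Nat.lt_floor_add_one _
    have h2 : (1 / 5 : ℝ) ≤ Real.log (5 / 4) := by
      have := Real.one_sub_inv_le_log_of_pos (show (0 : ℝ) < 5 / 4 by norm_num)
      norm_num at this ⊢
      exact this
    have h3 : Real.log n < Real.log ((5 / 4 : ℝ) ^ l) := by
      rw [Real.log_pow]
      have := mul_le_mul_of_nonneg_left h2 (Nat.cast_nonneg (α := ℝ) l)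
      linarith
    have h4 : (n : ℝ) < (5 / 4 : ℝ) ^ l :=
      (Real.log_lt_log_iff (by exact_mod_cast (by omega : 0 < n)) (by positivity)).1 h3
    rw [div_pow, lt_div_iff₀ (by positivity), mul_comm] at h4
    exact_mod_cast h4
  · rw [Nat.cast_add_one]
    have := Nat.floor_le (show (0 : ℝ) ≤ 5 * Real.log n by linarith)
    linarith

/-- A word whose bijective Burrows-Wheeler transform is Fibonacci-like has almost as many distinct
substrings of logarithmic length as possible. -/
theorem div_log_le_delta [LinearOrder α] {w : List α} {a b : α} (hab : a < b)
    (h : IsFibLike a b (bbwt w)) (hn : 2 ≤ w.length) :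
    (w.length : ℝ) / Real.log w.length ≤ 180 * delta w := by
  obtain ⟨l, hl, hl'⟩ := exists_pow_mul_lt_pow hn
  have hlog := log_two_le_log hn
  have hnd := nodup_map_omegaPrefix_of_isFibLike hab h hl
  have hK : ((3 * (2 * l + 1) : ℕ) : ℝ) ≤ 45 * Real.log w.length := by
    push_cast
    linarith
  have hdelta := one_le_delta (w := w) (by omega)
  rw [div_le_iff₀ (by linarith)]
  rcases Nat.lt_or_ge w.length (2 * (3 * (2 * l + 1))) with hlt | hge
  · have h1 : (w.length : ℝ) ≤ 2 * ((3 * (2 * l + 1) : ℕ) : ℝ) := by exact_mod_cast hlt.le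
    nlinarith
  · have h1 := le_two_mul_substringCount (isLyndonFactorization_lyndonFactors w) hnd (by omega)
      (by omega)
    have h2 := substringCount_le_mul_delta (w := w) (k := 3 * (2 * l + 1)) (by omega) (by omega)
    have h3 : (w.length : ℝ) ≤ 4 * (substringCount w (3 * (2 * l + 1)) : ℝ) := by
      exact_mod_cast (by omega : w.length ≤ 4 * substringCount w (3 * (2 * l + 1)))
    have h4 := mul_le_mul_of_nonneg_right hK (show 0 ≤ delta w by linarith)
    linarith

/-- Fibonacci numbers grow at least like `(3 / 2) ^ k`, so the index of a Fibonacci word is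
logarithmic in its length. -/
theorem pow_le_fib (k : ℕ) : (3 / 2 : ℝ) ^ k ≤ Nat.fib (k + 2) := by
  induction k using Nat.twoStepInduction with
  | zero => simp
  | one => norm_num [Nat.fib]
  | more k h1 h2 =>
    rw [Nat.fib_add_two (n := k + 2), Nat.cast_add]
    have h3 : (0 : ℝ) ≤ (3 / 2 : ℝ) ^ k := by positivity
    rw [pow_succ] at h2
    rw [pow_succ, pow_succ]
    have h2' : (3 / 2 : ℝ) ^ k * (3 / 2) ≤ Nat.fib (k + 2 + 1) := h2
    linarith

theorem le_log_fib (k : ℕ) : ((k + 1 : ℕ) : ℝ) ≤ 3 * Real.log (Nat.fib (k + 3)) := by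
  have h1 : Real.log ((3 / 2 : ℝ) ^ (k + 1)) ≤ Real.log (Nat.fib (k + 3)) :=
    Real.log_le_log (by positivity) (pow_le_fib (k + 1))
  rw [Real.log_pow] at h1
  have h2 : (1 / 3 : ℝ) ≤ Real.log (3 / 2) := by
    have := Real.one_sub_inv_le_log_of_pos (show (0 : ℝ) < 3 / 2 by norm_num)
    norm_num at this ⊢
    exact this
  have := mul_le_mul_of_nonneg_left h2 (Nat.cast_nonneg (α := ℝ) (k + 1))
  linarith

/-- An upper bound `12 * t` for a measure `x` of the transform (where `t` is `1` or `log n`) and a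
lower bound for the measure `y` of the word yield a bound for the ratio of `x` and `y`. -/
theorem combine_bounds {n : ℕ} (hn : 2 ≤ n) {x y t : ℝ} (ht : 0 ≤ t) (hx : x ≤ 12 * t)
    (hy : (n : ℝ) / Real.log n ≤ 180 * y) :
    x ≤ 2160 * (Real.log n * t / n) * y ∧ (n : ℝ) / Real.log n ≤ 2160 * y ∧ x ≤ 2160 * t := by
  have hlog : 0 < Real.log n := by
    have := log_two_le_log hn
    linarith
  have hn0 : (0 : ℝ) < n := by exact_mod_cast (by omega : 0 < n)
  have hpos : 0 < (n : ℝ) / Real.log n := by positivity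
  refine ⟨hx.trans ?_, by linarith, by linarith⟩
  rw [div_le_iff₀ hlog] at hy
  have h1 : 2160 * (Real.log n * t / n) * y = 12 * t * (180 * y * Real.log n) / n := by ring
  rw [h1, le_div_iff₀ hn0]
  exact mul_le_mul_of_nonneg_left hy (by linarith)

end StringMeasures

theorem mainTheorem1 :
    ∃ C : ℝ, 0 < C ∧
      ∀ (α : Type*) [LinearOrder α] (a b : α), a < b →
      ∀ (w : List α) (k n : ℕ),
        StringMeasures.bbwt w = StringMeasures.fibWord a b k →
        n = (StringMeasures.bbwt w).length → 2 ≤ n →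
        (∀ μ ∈ ({ fun x => StringMeasures.delta x,
                  fun x => (StringMeasures.gamma x : ℝ),
                  fun x => (StringMeasures.bmsSize x : ℝ),
                  fun x => (StringMeasures.lexSize x : ℝ),
                  fun x => (StringMeasures.bwtRuns x : ℝ) } : Set (List α → ℝ)),
          μ (StringMeasures.bbwt w) ≤ C * (Real.log n / n) * μ w ∧
          (n : ℝ) / Real.log n ≤ C * μ w ∧
          μ (StringMeasures.bbwt w) ≤ C) ∧
        (∀ μ ∈ ({ fun x => (StringMeasures.lzSize x : ℝ),
                  fun x => (StringMeasures.rlGrammarSize x : ℝ),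
                  fun x => (StringMeasures.grammarSize x : ℝ) } : Set (List α → ℝ)),
          μ (StringMeasures.bbwt w) ≤ C * (Real.log n ^ 2 / n) * μ w ∧
          (n : ℝ) / Real.log n ≤ C * μ w ∧
          μ (StringMeasures.bbwt w) ≤ C * Real.log n) := by
  refine ⟨2160, by norm_num, fun α _ a b hab w k n hw hn hn2 => ?_⟩
  obtain ⟨k, rfl⟩ : ∃ j, k = j + 2 := by
    refine Nat.exists_eq_add_of_le' ?_
    by_contra! hk
    rw [hn, hw, StringMeasures.length_fibWord] at hn2
    interval_cases k <;> simp at hn2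
  have hfib : StringMeasures.IsFibLike a b (StringMeasures.bbwt w) := by
    rw [hw]
    exact StringMeasures.isFibLike_fibWord hab.ne k
  have hlen : n = w.length := by rw [hn, StringMeasures.length_bbwt]
  have hlower := StringMeasures.div_log_le_delta hab hfib (hlen ▸ hn2)
  rw [← hlen] at hlower
  have hlog := StringMeasures.log_two_le_log hn2
  have hk : ((k + 1 : ℕ) : ℝ) ≤ 3 * Real.log n := by
    rw [hn, hw, StringMeasures.length_fibWord]
    exact StringMeasures.le_log_fib k
  -- every measure is at least `δ`
  have hγ := StringMeasures.delta_le_gamma w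
  have hb : (StringMeasures.gamma w : ℝ) ≤ StringMeasures.bmsSize w := by
    exact_mod_cast StringMeasures.gamma_le_bmsSize w
  have hv : (StringMeasures.bmsSize w : ℝ) ≤ StringMeasures.lexSize w := by
    exact_mod_cast StringMeasures.bmsSize_le_lexSize w
  have hr := StringMeasures.delta_le_bwtRuns w
  have hz : (StringMeasures.bmsSize w : ℝ) ≤ StringMeasures.lzSize w := by
    exact_mod_cast StringMeasures.bmsSize_le_lzSize w
  have hrl := StringMeasures.delta_le_rlGrammarSize w
  have hg : (StringMeasures.rlGrammarSize w : ℝ) ≤ StringMeasures.grammarSize w := by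
    exact_mod_cast StringMeasures.rlGrammarSize_le_grammarSize w
  -- the lex-parse of the Fibonacci word bounds `δ`, `γ` and `b`
  set s := StringMeasures.bbwt w with hs
  have hvs : (StringMeasures.lexSize s : ℝ) ≤ 4 := by
    rw [hw]
    exact_mod_cast StringMeasures.lexSize_fibWord_le hab.ne k
  have hbs : (StringMeasures.bmsSize s : ℝ) ≤ StringMeasures.lexSize s := by
    exact_mod_cast StringMeasures.bmsSize_le_lexSize s
  have hγs : (StringMeasures.gamma s : ℝ) ≤ StringMeasures.bmsSize s := by
    exact_mod_cast StringMeasures.gamma_le_bmsSize s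
  have hδs := StringMeasures.delta_le_gamma s
  have hrs : (StringMeasures.bwtRuns s : ℝ) ≤ 2 := by
    rw [hw]
    exact_mod_cast StringMeasures.bwtRuns_fibWord_le hab.ne k
  have hzs : (StringMeasures.lzSize s : ℝ) ≤ (k + 1 : ℕ) + 1 := by
    rw [hw]
    exact_mod_cast StringMeasures.lzSize_fibWord_le a b (k + 1)
  have hgs : (StringMeasures.grammarSize s : ℝ) ≤ 2 * ((k + 1 : ℕ) + 2) := by
    rw [hw]
    exact_mod_cast StringMeasures.grammarSize_fibWord_le a b (k + 2)
  have hrls : (StringMeasures.rlGrammarSize s : ℝ) ≤ StringMeasures.grammarSize s := by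
    exact_mod_cast StringMeasures.rlGrammarSize_le_grammarSize s
  have hconst : ∀ {x y : ℝ}, x ≤ 12 → StringMeasures.delta w ≤ y →
      x ≤ 2160 * (Real.log n / n) * y ∧ (n : ℝ) / Real.log n ≤ 2160 * y ∧ x ≤ 2160 := by
    intro x y hx hy
    have := StringMeasures.combine_bounds hn2 (t := 1) zero_le_one
      (by linarith : x ≤ 12 * 1) (y := y) (by linarith)
    simpa only [mul_one] using this
  have hlogs : ∀ {x y : ℝ}, x ≤ 12 * Real.log n → StringMeasures.delta w ≤ y →
      x ≤ 2160 * (Real.log n ^ 2 / n) * y ∧ (n : ℝ) / Real.log n ≤ 2160 * y ∧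
        x ≤ 2160 * Real.log n := by
    intro x y hx hy
    rw [sq]
    exact StringMeasures.combine_bounds hn2 (by linarith) hx (by linarith)
  simp only [Set.mem_insert_iff, Set.mem_singleton_iff, forall_eq_or_imp, forall_eq]
  refine ⟨⟨?_, ?_, ?_, ?_, ?_⟩, ?_, ?_, ?_⟩
  · exact hconst (by linarith) le_rfl
  · exact hconst (by linarith) (by linarith)
  · exact hconst (by linarith) (by linarith)
  · exact hconst (by linarith) (by linarith)
  · exact hconst (by linarith) hr
  · exact hlogs (by linarith) (by linarith)
  · exact hlogs (by linarith) hrl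
  · exact hlogs (by linarith) (by linarith)
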